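/- **Theorem 2.4 (second variation of the $\mathcal L$-length).** Let $M$ be a smooth $n$-manifold and let $g(\tau)$, $\tau\in[0,T]$, be a smooth solution of the backward Ricci flow $\partial_\tau g=2\,\mathrm{Ric}_{g(\tau)}$ on $M\times[0,T]$. At time $\tau$, write $\langle\cdot,\cdot\rangle$, $\nabla$, $\mathrm{Ric}$ and $R$ for the inner product, Levi-Civita connection, Ricci tensor and scalar curvature of $g(\tau)$; the curvature tensor is $R(U,V)W=\nabla_U\nabla_VW-\nabla_V\nabla_UW-\nabla_{[U,V]}W$. For $0<\bar\tau\le T$ and a curve $c:[0,\bar\tau]\to M$ put $$\mathcal L(c)=\int_0^{\bar\tau}\sqrt\tau\,\bigl(R(c(\tau),\tau)+|\dot c(\tau)|^2\bigr)\,d\tau .$$ Let $\gamma:[0,\bar\tau]\to M$ be an $\mathcal L$-geodesic, i.e. $\gamma$ is continuous on $[0,\bar\tau]$, smooth on $(0,\bar\tau]$, and there $X=\dot\gamma$ satisfies $$\nabla_XX-\tfrac12\nabla R+\tfrac1{2\tau}X+2\,\mathrm{Ric}(X,\cdot)=0 .$$ Let $\tilde\gamma:(-\varepsilon,\varepsilon)\times[0,\bar\tau]\to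 M$ be a variation with $\tilde\gamma(0,\cdot)=\gamma$ that is smooth as a function of $(s,\sqrt\tau)$, i.e. $(s,\sigma)\mapsto\tilde\gamma(s,\sigma^2)$ is smooth on $(-\varepsilon,\varepsilon)\times[0,\sqrt{\bar\tau}]$. Write $\gamma_s=\tilde\gamma(s,\cdot)$, $X=\partial_\tau\tilde\gamma$ and $Y=\partial_s\tilde\gamma$, all evaluated at $s=0$ in the formulas below. Then for $|s|<\varepsilon$ the integral defining $\mathcal L(\gamma_s)$ converges absolutely and $s\mapsto\mathcal L(\gamma_s)$ is differentiable on $(-\varepsilon,\varepsilon)$; its derivative is differentiable at $0$; and $\delta_Y^2\mathcal L:=\frac{d^2}{ds^2}\big|_{s=0}\mathcal L(\gamma_s)$ is given by $$\delta_Y^2\mathcal L=2\sqrt\tau\,\langle\nabla_YY,X\rangle\Big|_0^{\bar\tau}+\int_0^{\bar\tau}\sqrt\tau\Bigl[2|\nabla_XY|^2+2\langle R(Y,X)Y,X\rangle+\nabla_Y\nabla_YR+2(\nabla_X\mathrm{Ric})(Y,Y)-4(\nabla_Y\mathrm{Ric})(Y,X)\Bigr]d\tau .$$ Here $\nabla_Y\nabla_YR=\nabla^2R(Y,Y)$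 is the Hessian of $R$, the value of the boundary term at $0$ is $\lim_{\tau\to0^+}2\sqrt\tau\,\langle\nabla_YY,X\rangle$, which exists, and the integral converges absolutely. -/

import Mathlib

open Set Filter Topology Manifold
open scoped ContDiff

set_option maxSynthPendingDepth 3

noncomputable section

namespace RicciL

/-! ### Riemannian geometry in coordinates

`G : E → E →L[ℝ] E →L[ℝ] ℝ` is the coordinate expression `y ↦ (g_{ij}(y))` of a Riemannian metric
on an open subset of the finite-dimensional vector space `E`. -/

section Coordinates

variable {E : Type*} [NormedAddCommGroup E] [NormedSpace ℝ E]

/-- The trace of an endomorphism, as a continuous linear form. -/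
def traceL (E : Type*) [NormedAddCommGroup E] [NormedSpace ℝ E] [FiniteDimensional ℝ E] :
    (E →L[ℝ] E) →L[ℝ] ℝ :=
  LinearMap.toContinuousLinearMap (LinearMap.trace ℝ E ∘ₗ ContinuousLinearMap.coeLM ℝ)

theorem traceL_apply [FiniteDimensional ℝ E] (A : E →L[ℝ] E) : traceL E A = LinearMap.trace ℝ E (A : E →ₗ[ℝ] E) := rfl

/-- Christoffel symbols of the first kind,
`Γ₁(u, v, w) = (∂_u G(v, w) + ∂_v G(u, w) - ∂_w G(u, v)) / 2`. -/
def christoffelFirst (G : E → E →L[ℝ] E →L[ℝ] ℝ) (y : E) : E →L[ℝ] E →L[ℝ] E →L[ℝ] ℝ :=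
  let swap : (E →L[ℝ] E →L[ℝ] ℝ) →L[ℝ] E →L[ℝ] E →L[ℝ] ℝ :=
    (ContinuousLinearMap.flipₗᵢ ℝ E E ℝ).toContinuousLinearEquiv
  let D : E →L[ℝ] E →L[ℝ] E →L[ℝ] ℝ := fderiv ℝ G y
  (1 / 2 : ℝ) • (D + D.flip - swap.comp D.flip)

theorem christoffelFirst_apply (G : E → E →L[ℝ] E →L[ℝ] ℝ) (y u v w : E) :
    christoffelFirst G y u v w
      = (fderiv ℝ G y u v w + fderiv ℝ G y v u w - fderiv ℝ G y w u v) / 2 := by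
  simp [christoffelFirst]
  ring

/-- Raising an index: the inverse of the isomorphism `v ↦ G(v, ·)` from vectors to covectors. -/
def sharp (G : E → E →L[ℝ] E →L[ℝ] ℝ) (y : E) : (E →L[ℝ] ℝ) →L[ℝ] E :=
  (G y).inverse

/-- Christoffel symbols of the second kind: `Γ(u, v)` is the vector with
`G(Γ(u, v), w) = Γ₁(u, v, w)` for all `w`. -/
def christoffel (G : E → E →L[ℝ] E →L[ℝ] ℝ) (y : E) : E →L[ℝ] E →L[ℝ] E :=
  ContinuousLinearMap.compL ℝ E (E →L[ℝ] ℝ) E (sharp G y) ∘L christoffelFirst G y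

theorem christoffel_apply (G : E → E →L[ℝ] E →L[ℝ] ℝ) (y u v : E) :
    christoffel G y u v = sharp G y (christoffelFirst G y u v) := rfl

/-- The Riemann curvature tensor `R(u, v)w`, with the sign convention
`R(X, Y)Z = ∇_X ∇_Y Z - ∇_Y ∇_X Z - ∇_{[X, Y]} Z`. -/
def riemann (G : E → E →L[ℝ] E →L[ℝ] ℝ) (y : E) : E →L[ℝ] E →L[ℝ] E →L[ℝ] E :=
  let A := fderiv ℝ (christoffel G) y
  let B := (ContinuousLinearMap.compL ℝ E E E).bilinearComp (christoffel G y) (christoffel G y)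
  A - A.flip + B - B.flip

theorem riemann_apply (G : E → E →L[ℝ] E →L[ℝ] ℝ) (y u v w : E) :
    riemann G y u v w
      = fderiv ℝ (christoffel G) y u v w - fderiv ℝ (christoffel G) y v u w
        + christoffel G y u (christoffel G y v w) - christoffel G y v (christoffel G y u w) := by
  simp [riemann]

/-- The Ricci tensor `Ric(u, v) = tr (w ↦ R(w, u)v)`. -/
def ricci [FiniteDimensional ℝ E] (G : E → E →L[ℝ] E →L[ℝ] ℝ) (y : E) : E →L[ℝ] E →L[ℝ] ℝ :=
  let swap : (E →L[ℝ] E →L[ℝ] E) →L[ℝ] E →L[ℝ] E →L[ℝ] E :=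
    (ContinuousLinearMap.flipₗᵢ ℝ E E E).toContinuousLinearEquiv
  (ContinuousLinearMap.compL ℝ E (E →L[ℝ] E) ℝ (traceL E)).comp (swap.comp (riemann G y).flip)

theorem ricci_apply [FiniteDimensional ℝ E] (G : E → E →L[ℝ] E →L[ℝ] ℝ) (y u v : E) :
    ricci G y u v
      = LinearMap.trace ℝ E
          ({ toFun := fun w => riemann G y w u v
             map_add' := by simp
             map_smul' := by simp } : E →ₗ[ℝ] E) := rfl

/-- The Ricci endomorphism `u ↦ Ric(u, ·)^♯`. -/
def ricciSharp [FiniteDimensional ℝ E] (G : E → E →L[ℝ] E →L[ℝ] ℝ) (y : E) : E →L[ℝ] E :=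
  sharp G y ∘L ricci G y

/-- The scalar curvature, i.e. the trace of the Ricci endomorphism. -/
def scalar [FiniteDimensional ℝ E] (G : E → E →L[ℝ] E →L[ℝ] ℝ) (y : E) : ℝ :=
  traceL E (ricciSharp G y)

/-- The covariant derivative of the Ricci tensor,
`(∇_w Ric)(u, v) = ∂_w (Ric(u, v)) - Ric(Γ(w, u), v) - Ric(u, Γ(w, v))`. -/
def nablaRicci [FiniteDimensional ℝ E] (G : E → E →L[ℝ] E →L[ℝ] ℝ) (y w u v : E) : ℝ :=
  fderiv ℝ (ricci G) y w u v - ricci G y (christoffel G y w u) v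
    - ricci G y u (christoffel G y w v)

/-- The Hessian of a function, `∇²f(u, v) = ∂_u ∂_v f - ∂_{Γ(u, v)} f`. -/
def hessian (G : E → E →L[ℝ] E →L[ℝ] ℝ) (f : E → ℝ) (y u v : E) : ℝ :=
  fderiv ℝ (fderiv ℝ f) y u v - fderiv ℝ f y (christoffel G y u v)

/-- The gradient of a function. -/
def gradient (G : E → E →L[ℝ] E →L[ℝ] ℝ) (f : E → ℝ) (y : E) : E :=
  sharp G y (fderiv ℝ f y)

end Coordinates

/-! ### Riemannian metrics on a manifold

In Mathlib a tangent vector at `x` is its coordinate vector in the preferred chart at `x`, i.e.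
`TangentSpace (𝓡 n) x` is `EuclideanSpace ℝ (Fin n)` and the derivative at `x` of the preferred
chart `extChartAt (𝓡 n) x` is the identity.  Hence the value at `x` of a tensor is the value of its
coordinate expression in that chart at the image of `x`. -/

section Manifold

variable {n : ℕ} {M : Type*} [TopologicalSpace M] [ChartedSpace (EuclideanSpace ℝ (Fin n)) M]
  [IsManifold (𝓡 n) ∞ M]

/-- Smooth Riemannian metrics on the `n`-manifold `M`. -/
abbrev Metric (n : ℕ) (M : Type*) [TopologicalSpace M]
    [ChartedSpace (EuclideanSpace ℝ (Fin n)) M] [IsManifold (𝓡 n) ∞ M] :=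
  Bundle.ContMDiffRiemannianMetric (𝓡 n) ∞ (EuclideanSpace ℝ (Fin n))
    (fun x : M => TangentSpace (𝓡 n) x)

/-- The coordinate expression of the metric `g` in the chart around `c`: at the point `y` of the
image of the chart it is `(u, v) ↦ g (Dφ⁻¹(y) u, Dφ⁻¹(y) v)`, where `φ` is the chart. -/
def Metric.coord (g : Metric n M) (c : M) (y : EuclideanSpace ℝ (Fin n)) :
    EuclideanSpace ℝ (Fin n) →L[ℝ] EuclideanSpace ℝ (Fin n) →L[ℝ] ℝ :=
  let A : EuclideanSpace ℝ (Fin n) →L[ℝ] EuclideanSpace ℝ (Fin n) :=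
    mfderiv 𝓘(ℝ, EuclideanSpace ℝ (Fin n)) (𝓡 n) (extChartAt (𝓡 n) c).symm y
  let B : EuclideanSpace ℝ (Fin n) →L[ℝ] EuclideanSpace ℝ (Fin n) →L[ℝ] ℝ :=
    g.inner ((extChartAt (𝓡 n) c).symm y)
  B.bilinearComp A A

theorem Metric.coord_apply (g : Metric n M) (c : M) (y u v : EuclideanSpace ℝ (Fin n)) :
    g.coord c y u v = g.inner ((extChartAt (𝓡 n) c).symm y)
      (mfderiv 𝓘(ℝ, EuclideanSpace ℝ (Fin n)) (𝓡 n) (extChartAt (𝓡 n) c).symm y u)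
      (mfderiv 𝓘(ℝ, EuclideanSpace ℝ (Fin n)) (𝓡 n) (extChartAt (𝓡 n) c).symm y v) := rfl

/-- The Riemann curvature tensor `R(u, v)w` of `g` at `x`. -/
def Metric.riemannAt (g : Metric n M) (x : M) (u v w : TangentSpace (𝓡 n) x) :
    TangentSpace (𝓡 n) x :=
  riemann (g.coord x) (extChartAt (𝓡 n) x x) u v w

/-- The Ricci tensor of `g` at `x`. -/
def Metric.ricciAt (g : Metric n M) (x : M) (u v : TangentSpace (𝓡 n) x) : ℝ :=
  ricci (g.coord x) (extChartAt (𝓡 n) x x) u v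

/-- The vector `Ric(u, ·)` at `x`, dual to the covector `v ↦ Ric(u, v)`. -/
def Metric.ricciSharpAt (g : Metric n M) (x : M) (u : TangentSpace (𝓡 n) x) :
    TangentSpace (𝓡 n) x :=
  ricciSharp (g.coord x) (extChartAt (𝓡 n) x x) u

/-- The scalar curvature of `g` at `x`. -/
def Metric.scalarAt (g : Metric n M) (x : M) : ℝ :=
  scalar (g.coord x) (extChartAt (𝓡 n) x x)

/-- `(∇_w Ric)(u, v)` at `x`. -/
def Metric.nablaRicciAt (g : Metric n M) (x : M) (w u v : TangentSpace (𝓡 n) x) : ℝ :=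
  nablaRicci (g.coord x) (extChartAt (𝓡 n) x x) w u v

/-- The gradient at `x` of a function on `M`. -/
def Metric.gradientAt (g : Metric n M) (f : M → ℝ) (x : M) : TangentSpace (𝓡 n) x :=
  (gradient (g.coord x) (f ∘ (extChartAt (𝓡 n) x).symm) (extChartAt (𝓡 n) x x) :
    EuclideanSpace ℝ (Fin n))

/-- The Hessian `∇²f(u, v)` at `x` of a function on `M`. -/
def Metric.hessianAt (g : Metric n M) (f : M → ℝ) (x : M) (u v : TangentSpace (𝓡 n) x) : ℝ :=
  hessian (g.coord x) (f ∘ (extChartAt (𝓡 n) x).symm) (extChartAt (𝓡 n) x x) u v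

/-- The velocity at time `t` of a curve parametrized by the set `S` of times
(one-sided at the end points if `S` is an interval). -/
def velocity (S : Set ℝ) (c : ℝ → M) (t : ℝ) : TangentSpace (𝓡 n) (c t) :=
  mfderivWithin 𝓘(ℝ, ℝ) (𝓡 n) c S t (1 : ℝ)

/-- The covariant derivative at time `t`, for the Levi-Civita connection of `g`, of a vector field
`V` along the curve `c`: in the chart around `c t` it is `dV/dt + Γ(dc/dt, V)`. -/
def Metric.covDeriv (g : Metric n M) (S : Set ℝ) (c : ℝ → M)
    (V : ∀ t, TangentSpace (𝓡 n) (c t)) (t : ℝ) : TangentSpace (𝓡 n) (c t) :=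
  let dV : EuclideanSpace ℝ (Fin n) := derivWithin (fun r => (mfderiv (𝓡 n)
    𝓘(ℝ, EuclideanSpace ℝ (Fin n)) (extChartAt (𝓡 n) (c t)) (c r) (V r) :
      EuclideanSpace ℝ (Fin n))) S t
  let Γ : EuclideanSpace ℝ (Fin n) :=
    christoffel (g.coord (c t)) (extChartAt (𝓡 n) (c t) (c t)) (velocity S c t) (V t)
  dV + Γ

/-- `g` is a smooth solution of the backward Ricci flow `∂g/∂τ = 2 Ric` on `M × [0, T]`. -/
structure IsBackwardRicciFlow (g : ℝ → Metric n M) (T : ℝ) : Prop where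
  smooth : ContMDiffOn (𝓘(ℝ, ℝ).prod (𝓡 n))
    ((𝓡 n).prod 𝓘(ℝ, EuclideanSpace ℝ (Fin n) →L[ℝ] EuclideanSpace ℝ (Fin n) →L[ℝ] ℝ)) ∞
    (fun p : ℝ × M => (Bundle.TotalSpace.mk'
      (EuclideanSpace ℝ (Fin n) →L[ℝ] EuclideanSpace ℝ (Fin n) →L[ℝ] ℝ) p.2 ((g p.1).inner p.2) :
      Bundle.TotalSpace (EuclideanSpace ℝ (Fin n) →L[ℝ] EuclideanSpace ℝ (Fin n) →L[ℝ] ℝ)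
        (fun x : M => TangentSpace (𝓡 n) x →L[ℝ] TangentSpace (𝓡 n) x →L[ℝ] ℝ)))
    (Icc 0 T ×ˢ univ)
  evolution : ∀ τ ∈ Icc 0 T, ∀ (x : M) (u v : TangentSpace (𝓡 n) x),
    HasDerivWithinAt (fun r => (g r).inner x u v) (2 * (g τ).ricciAt x u v) (Icc 0 T) τ

/-- The integrand `√τ (R(γ(τ), τ) + |γ'(τ)|²)` of the `ℒ`-length, with scalar curvature and norm
taken with respect to `g(τ)`. -/
def lengthIntegrand (g : ℝ → Metric n M) (τ₁ τ₂ : ℝ) (c : ℝ → M) (τ : ℝ) : ℝ :=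
  √τ * ((g τ).scalarAt (c τ) +
    (g τ).inner (c τ) (velocity (Icc τ₁ τ₂) c τ) (velocity (Icc τ₁ τ₂) c τ))

/-- The `ℒ`-length of a curve `c : [τ₁, τ₂] → M`. -/
def lLength (g : ℝ → Metric n M) (τ₁ τ₂ : ℝ) (c : ℝ → M) : ℝ :=
  ∫ τ in τ₁..τ₂, lengthIntegrand g τ₁ τ₂ c τ

/-- `c : [τ₁, τ₂] → M` is an `ℒ`-geodesic: it is continuous, and for `τ > 0` it is smooth and
satisfies `∇_X X - ∇R / 2 + X / (2τ) + 2 Ric(X, ·) = 0`, where `X = c'`. -/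
structure IsLGeodesic (g : ℝ → Metric n M) (τ₁ τ₂ : ℝ) (c : ℝ → M) : Prop where
  continuousOn : ContinuousOn c (Icc τ₁ τ₂)
  smooth : ContMDiffOn 𝓘(ℝ, ℝ) (𝓡 n) ∞ c (Icc τ₁ τ₂ ∩ Ioi 0)
  equation : ∀ τ ∈ Icc τ₁ τ₂, 0 < τ →
    (g τ).covDeriv (Icc τ₁ τ₂) c (velocity (Icc τ₁ τ₂) c) τ
      - (1 / 2 : ℝ) • (g τ).gradientAt (g τ).scalarAt (c τ)
      + (1 / (2 * τ)) • velocity (Icc τ₁ τ₂) c τ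
      + (2 : ℝ) • (g τ).ricciSharpAt (c τ) (velocity (Icc τ₁ τ₂) c τ) = 0

/-! ### Variations

`γ : ℝ → ℝ → M` is a variation `(s, τ) ↦ γ s τ`, with `s` near `0` and `τ ∈ [0, b]`.  The fields
below live along the central curve `γ 0`; covariant derivatives at time `τ` are those of `g(τ)`. -/

/-- `X = ∂γ/∂τ` at `s = 0`. -/
def fieldX (b : ℝ) (γ : ℝ → ℝ → M) (τ : ℝ) : TangentSpace (𝓡 n) (γ 0 τ) :=
  velocity (Icc 0 b) (γ 0) τ

/-- `Y = ∂γ/∂s` at `s = 0`. -/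
def fieldY (γ : ℝ → ℝ → M) (τ : ℝ) : TangentSpace (𝓡 n) (γ 0 τ) :=
  velocity univ (fun s => γ s τ) 0

/-- `∇_X Y` at `s = 0`. -/
def nablaXY (g : ℝ → Metric n M) (b : ℝ) (γ : ℝ → ℝ → M) (τ : ℝ) : TangentSpace (𝓡 n) (γ 0 τ) :=
  (g τ).covDeriv (Icc 0 b) (γ 0) (fieldY γ) τ

/-- `∇_Y Y` at `s = 0`. -/
def nablaYY (g : ℝ → Metric n M) (γ : ℝ → ℝ → M) (τ : ℝ) : TangentSpace (𝓡 n) (γ 0 τ) :=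
  (g τ).covDeriv univ (fun s => γ s τ) (velocity univ (fun s => γ s τ)) 0

/-- The boundary term `2 √τ ⟨∇_Y Y, X⟩`. -/
def boundaryTerm (g : ℝ → Metric n M) (b : ℝ) (γ : ℝ → ℝ → M) (τ : ℝ) : ℝ :=
  2 * √τ * (g τ).inner (γ 0 τ) (nablaYY g γ τ) (fieldX b γ τ)

/-- The integrand `√τ (2|∇_X Y|² + 2⟨R(Y, X)Y, X⟩ + ∇_Y ∇_Y R + 2(∇_X Ric)(Y, Y)
- 4(∇_Y Ric)(Y, X))`, where `∇_Y ∇_Y R` is the Hessian of `R` applied to `(Y, Y)`. -/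
def secondVariationIntegrand (g : ℝ → Metric n M) (b : ℝ) (γ : ℝ → ℝ → M) (τ : ℝ) : ℝ :=
  let x : M := γ 0 τ
  let X : TangentSpace (𝓡 n) x := fieldX b γ τ
  let Y : TangentSpace (𝓡 n) x := fieldY γ τ
  √τ * (2 * (g τ).inner x (nablaXY g b γ τ) (nablaXY g b γ τ)
    + 2 * (g τ).inner x ((g τ).riemannAt x Y X Y) X
    + (g τ).hessianAt (g τ).scalarAt x Y Y
    + 2 * (g τ).nablaRicciAt x X Y Y
    - 4 * (g τ).nablaRicciAt x Y Y X)

end Manifold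

end RicciL

end

/-! Put `σ = √τ` and `V = ∂_σ = 2σX`. The `ℒ`-length becomes the integral over `[0, √b]` of `2σ²R +
|V|²/2`, and for a variation smooth in `(s, σ)` this density is smooth up to the edge `σ = 0`.
Convergence of the integral and both differentiations under it then follow by compactness. Only a
pointwise formula for the second `s`-derivative of the density remains.

Since the connection is torsion free, the first `s`-derivative is `2σ² dR(Y) + ⟨∇_V Y, V⟩`.
Differentiating again gives `2σ²(∇²R(Y, Y) + dR(∇_Y Y)) + |∇_V Y|² + ⟨∇_Y ∇_V Y, V⟩`. Commuting
`∇_Y` and `∇_V` produces `R(Y, V)Y`, and also `-2σ Γ̇(Y, Y)`, because the connection is that of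
`g(σ²)`. Under the flow, `⟨Γ̇(Y, Y), V⟩ = 2(∇_Y Ric)(Y, V) - (∇_V Ric)(Y, Y)`, which is the source
of the two Ricci terms (`IsFlowOn.apply_christoffelDot`, `IsVariationOn.covD_covD`).

What is left is `⟨∇_V ∇_Y Y, V⟩`. It equals `∂_σ⟨∇_Y Y, V⟩ - ⟨∇_Y Y, ∇_V V⟩ - 4σ Ric(∇_Y Y, V)`, the
last term coming from the motion of the metric. In the variable `σ` the geodesic equation is
regular, `∇_V V = 2σ²∇R - 4σ Ric(V, ·)`, so all terms linear in `∇_Y Y` cancel except the exact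
derivative (`IsVariationOn.pd_pd_energy`). The fundamental theorem of calculus turns it into the
boundary term, because `⟨∇_Y Y, V⟩ = 2√τ⟨∇_Y Y, X⟩`, and its smoothness at `σ = 0` gives the limit
there.

The identity is proved in a fixed chart, whereas the tensors of the statement are evaluated at each
point in the preferred chart of that point. Quantities that get differentiated must therefore be
chart independent: this is shown for the metric, the Ricci tensor and the scalar curvature through
their behaviour under pullback. All other tensors are needed only at one point, in its own chart. -/

namespace RicciL

/-! ### Algebra of the Levi-Civita connection in coordinates. -/

section CoordinateMetric

variable {E : Type*} [NormedAddCommGroup E] [NormedSpace ℝ E]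

/-- `G` is the coordinate expression of a Riemannian metric near `y`. -/
structure IsMetricAt (G : E → E →L[ℝ] E →L[ℝ] ℝ) (y : E) : Prop where
  eventually_smooth : ∀ᶠ z in 𝓝 y, ContDiffAt ℝ ∞ G z
  symm : ∀ᶠ z in 𝓝 y, ∀ u v, G z u v = G z v u
  pos : ∀ᶠ z in 𝓝 y, ∀ u, u ≠ 0 → 0 < G z u u

/-- Positivity gives injectivity, and equality of dimensions gives the rest. Invertibility matters
because `sharp` is an `inverse`, which has the default value `0` at a non-invertible map. -/
theorem isInvertible_of_pos [FiniteDimensional ℝ E] {B : E →L[ℝ] E →L[ℝ] ℝ}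
    (h : ∀ u, u ≠ 0 → 0 < B u u) : B.IsInvertible := by
  have hinj : LinearMap.ker (B : E →ₗ[ℝ] E →L[ℝ] ℝ) = ⊥ := by
    refine LinearMap.ker_eq_bot'.2 fun u hu => ?_
    by_contra hne
    have := h u hne
    have h0 : B u = 0 := hu
    simp [h0] at this
  let e₀ : (E →ₗ[ℝ] ℝ) ≃ₗ[ℝ] (E →L[ℝ] ℝ) := LinearMap.toContinuousLinearMap
  have hdim : Module.finrank ℝ E = Module.finrank ℝ (E →L[ℝ] ℝ) := by
    rw [← e₀.finrank_eq]
    exact (Subspace.dual_finrank_eq (K := ℝ) (V := E)).symm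
  let e := LinearEquiv.ofInjectiveOfFinrankEq (B : E →ₗ[ℝ] E →L[ℝ] ℝ)
    (LinearMap.ker_eq_bot.1 hinj) hdim
  exact ⟨e.toContinuousLinearEquiv, by ext; rfl⟩

theorem apply_sharp {G : E → E →L[ℝ] E →L[ℝ] ℝ} {y : E} (h : (G y).IsInvertible)
    (α : E →L[ℝ] ℝ) : G y (sharp G y α) = α := by
  obtain ⟨e, he⟩ := h
  rw [sharp, ← he, ContinuousLinearMap.inverse_equiv]
  simp

/-- `christoffel` and `ricciSharp` are known explicitly only after pairing with the metric, so
identities between vectors are checked there. -/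
theorem eq_of_apply_eq {B : E →L[ℝ] E →L[ℝ] ℝ} (h : B.IsInvertible) {u v : E}
    (huv : ∀ w, B u w = B v w) : u = v := by
  obtain ⟨e, he⟩ := h
  refine e.injective ?_
  change (e : E →L[ℝ] E →L[ℝ] ℝ) u = (e : E →L[ℝ] E →L[ℝ] ℝ) v
  rw [he]
  exact ContinuousLinearMap.ext huv

theorem apply_christoffel {G : E → E →L[ℝ] E →L[ℝ] ℝ} {y : E} (h : (G y).IsInvertible)
    (u v w : E) : G y (christoffel G y u v) w
      = (fderiv ℝ G y u v w + fderiv ℝ G y v u w - fderiv ℝ G y w u v) / 2 := by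
  rw [christoffel_apply, apply_sharp h, christoffelFirst_apply]

theorem apply_ricciSharp [FiniteDimensional ℝ E] {G : E → E →L[ℝ] E →L[ℝ] ℝ} {y : E}
    (h : (G y).IsInvertible) (u v : E) : G y (ricciSharp G y u) v = ricci G y u v := by
  change G y (sharp G y (ricci G y u)) v = _
  rw [apply_sharp h]

theorem apply_gradient {G : E → E →L[ℝ] E →L[ℝ] ℝ} {y : E}
    (h : (G y).IsInvertible) (f : E → ℝ) (v : E) : G y (gradient G f y) v = fderiv ℝ f y v := by
  rw [gradient, apply_sharp h]

theorem fderiv_symm {G : E → E →L[ℝ] E →L[ℝ] ℝ} {y : E} (hd : DifferentiableAt ℝ G y)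
    (hs : ∀ᶠ z in 𝓝 y, ∀ u v, G z u v = G z v u) (w u v : E) :
    fderiv ℝ G y w u v = fderiv ℝ G y w v u := by
  have key : ∀ u v : E, fderiv ℝ (fun z => G z u v) y w = fderiv ℝ G y w u v := by
    intro u v
    have := ((hd.hasFDerivAt.clm_apply (hasFDerivAt_const u y)).clm_apply
      (hasFDerivAt_const v y)).fderiv
    rw [this]; simp
  rw [← key u v, ← key v u]
  have : (fun z => G z u v) =ᶠ[𝓝 y] fun z => G z v u := hs.mono fun z hz => hz u v
  rw [this.fderiv_eq]

theorem IsMetricAt.isInvertible [FiniteDimensional ℝ E] {G : E → E →L[ℝ] E →L[ℝ] ℝ} {y : E}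
    (h : IsMetricAt G y) : (G y).IsInvertible :=
  isInvertible_of_pos h.pos.self_of_nhds

theorem IsMetricAt.smooth {G : E → E →L[ℝ] E →L[ℝ] ℝ} {y : E} (h : IsMetricAt G y) :
    ContDiffAt ℝ ∞ G y := h.eventually_smooth.self_of_nhds

theorem IsMetricAt.differentiableAt {G : E → E →L[ℝ] E →L[ℝ] ℝ} {y : E} (h : IsMetricAt G y) :
    DifferentiableAt ℝ G y := h.smooth.differentiableAt (by simp)

theorem IsMetricAt.christoffel_symm [FiniteDimensional ℝ E] {G : E → E →L[ℝ] E →L[ℝ] ℝ} {y : E}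
    (h : IsMetricAt G y) (u v : E) : christoffel G y u v = christoffel G y v u := by
  refine eq_of_apply_eq h.isInvertible fun w => ?_
  rw [apply_christoffel h.isInvertible, apply_christoffel h.isInvertible,
    fderiv_symm h.differentiableAt h.symm w u v]
  ring

/-- The Levi-Civita connection is compatible with the metric. -/
theorem IsMetricAt.fderiv_apply [FiniteDimensional ℝ E] {G : E → E →L[ℝ] E →L[ℝ] ℝ} {y : E}
    (h : IsMetricAt G y) (u v w : E) : fderiv ℝ G y u v w
      = G y (christoffel G y u v) w + G y v (christoffel G y u w) := by
  rw [h.symm.self_of_nhds v, apply_christoffel h.isInvertible, apply_christoffel h.isInvertible,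
    fderiv_symm h.differentiableAt h.symm u w v, fderiv_symm h.differentiableAt h.symm w u v]
  ring

end CoordinateMetric

/-! ### Joint smoothness in time and space of the curvature quantities. -/

section JointSmoothness

variable {E F : Type*} [NormedAddCommGroup E] [NormedSpace ℝ E]
  [NormedAddCommGroup F] [NormedSpace ℝ F]

/-- Only time is confined to `J`; each spatial slice is the whole of `E`. The spatial derivative is
thus a full derivative with time as a parameter, and one-sided smoothness at the ends of the time
interval survives. -/
theorem contDiffWithinAt_partial_fderiv {H : ℝ → E → F} {J : Set ℝ} {τ : ℝ} {y : E} (hτ : τ ∈ J)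
    (h : ContDiffWithinAt ℝ ∞ (fun p : ℝ × E => H p.1 p.2) (J ×ˢ univ) (τ, y)) :
    ContDiffWithinAt ℝ ∞ (fun p : ℝ × E => fderiv ℝ (H p.1) p.2) (J ×ˢ univ) (τ, y) := by
  simp only [← fderivWithin_univ]
  refine ContDiffWithinAt.fderivWithin (f := fun p : ℝ × E => H p.1) (g := Prod.snd) (n := ∞)
    ?_ contDiffWithinAt_snd uniqueDiffOn_univ (by simp) (by simp [hτ]) (by simp)
  refine ContDiffWithinAt.comp (t := J ×ˢ (univ : Set E)) ((τ, y), y)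
    (g := fun p : ℝ × E => H p.1 p.2) (f := fun q : (ℝ × E) × E => (q.1.1, q.2)) h ?_ ?_
  · exact (contDiff_fst.fst.prodMk contDiff_snd).contDiffWithinAt
  · rintro ⟨⟨r, z⟩, z'⟩ ⟨⟨h1, -⟩, -⟩
    exact ⟨h1, mem_univ _⟩

/-- A smooth function of time and space is smooth in space. -/
theorem contDiffAt_of_joint {H : ℝ → E → F} {J : Set ℝ} {τ : ℝ} {y : E} (hτ : τ ∈ J)
    (h : ContDiffWithinAt ℝ ∞ (fun p : ℝ × E => H p.1 p.2) (J ×ˢ univ) (τ, y)) :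
    ContDiffAt ℝ ∞ (H τ) y := by
  rw [← contDiffWithinAt_univ]
  exact ContDiffWithinAt.comp (g := fun p : ℝ × E => H p.1 p.2) (f := fun z : E => (τ, z)) y h
    (contDiff_const.prodMk contDiff_id).contDiffWithinAt (fun z _ => ⟨hτ, mem_univ _⟩)

theorem IsMetricAt.eventually {G : E → E →L[ℝ] E →L[ℝ] ℝ} {y : E}
    (h : IsMetricAt G y) :
    ∀ᶠ z in 𝓝 y, IsMetricAt G z := by
  filter_upwards [h.eventually_smooth.eventually_nhds, h.symm.eventually_nhds,
    h.pos.eventually_nhds] with z h1 h2 h3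
  exact ⟨h1, h2, h3⟩

variable [FiniteDimensional ℝ E] {G : ℝ → E → E →L[ℝ] E →L[ℝ] ℝ} {J : Set ℝ} {τ : ℝ} {y : E}

theorem contDiffWithinAt_sharp (hi : (G τ y).IsInvertible)
    (h : ContDiffWithinAt ℝ ∞ (fun p : ℝ × E => G p.1 p.2) (J ×ˢ univ) (τ, y)) :
    ContDiffWithinAt ℝ ∞ (fun p : ℝ × E => sharp (G p.1) p.2) (J ×ˢ univ) (τ, y) := by
  have : CompleteSpace E := FiniteDimensional.complete ℝ E
  exact ContDiffAt.comp_contDiffWithinAt (g := ContinuousLinearMap.inverse)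
    (f := fun p : ℝ × E => G p.1 p.2) (τ, y) hi.contDiffAt_map_inverse h

theorem contDiffWithinAt_christoffel (hτ : τ ∈ J) (hi : (G τ y).IsInvertible)
    (h : ContDiffWithinAt ℝ ∞ (fun p : ℝ × E => G p.1 p.2) (J ×ˢ univ) (τ, y)) :
    ContDiffWithinAt ℝ ∞ (fun p : ℝ × E => christoffel (G p.1) p.2) (J ×ˢ univ) (τ, y) := by
  have hD := contDiffWithinAt_partial_fderiv hτ h
  have hflip := (ContinuousLinearMap.flipₗᵢ ℝ E E (E →L[ℝ] ℝ)).contDiff (n := ∞)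
    |>.contDiffAt.comp_contDiffWithinAt _ hD
  have h1 : ContDiffWithinAt ℝ ∞ (fun p : ℝ × E => christoffelFirst (G p.1) p.2)
      (J ×ˢ univ) (τ, y) :=
    (((hD.add hflip).sub (contDiffWithinAt_const.clm_comp hflip)).const_smul (1 / 2 : ℝ))
  have h2 := (ContinuousLinearMap.compL ℝ E (E →L[ℝ] ℝ) E).contDiff (n := ∞)
    |>.contDiffAt.comp_contDiffWithinAt _ (contDiffWithinAt_sharp hi h)
  exact h2.clm_comp h1

theorem contDiffWithinAt_riemann (hτ : τ ∈ J) (hi : (G τ y).IsInvertible)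
    (h : ContDiffWithinAt ℝ ∞ (fun p : ℝ × E => G p.1 p.2) (J ×ˢ univ) (τ, y)) :
    ContDiffWithinAt ℝ ∞ (fun p : ℝ × E => riemann (G p.1) p.2) (J ×ˢ univ) (τ, y) := by
  have hΓ := contDiffWithinAt_christoffel hτ hi h
  have hA := contDiffWithinAt_partial_fderiv (H := fun r => christoffel (G r)) hτ hΓ
  have hflip : ∀ {f : ℝ × E → E →L[ℝ] E →L[ℝ] E →L[ℝ] E},
      ContDiffWithinAt ℝ ∞ f (J ×ˢ univ) (τ, y) →
      ContDiffWithinAt ℝ ∞ (fun p => (f p).flip) (J ×ˢ univ) (τ, y) := fun hf =>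
    (ContinuousLinearMap.flipₗᵢ ℝ E E (E →L[ℝ] E)).contDiff (n := ∞)
      |>.contDiffAt.comp_contDiffWithinAt _ hf
  have h1 : ContDiffWithinAt ℝ ∞ (fun p : ℝ × E => (ContinuousLinearMap.compL ℝ E E E).comp
      (christoffel (G p.1) p.2)) (J ×ˢ univ) (τ, y) := contDiffWithinAt_const.clm_comp hΓ
  have h2 := (ContinuousLinearMap.flipₗᵢ ℝ E (E →L[ℝ] E) (E →L[ℝ] E)).contDiff (n := ∞)
      |>.contDiffAt.comp_contDiffWithinAt _ h1
  have hB := hflip (h2.clm_comp hΓ)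
  exact ((hA.sub (hflip hA)).add hB).sub (hflip hB)

theorem contDiffWithinAt_ricci (hτ : τ ∈ J) (hi : (G τ y).IsInvertible)
    (h : ContDiffWithinAt ℝ ∞ (fun p : ℝ × E => G p.1 p.2) (J ×ˢ univ) (τ, y)) :
    ContDiffWithinAt ℝ ∞ (fun p : ℝ × E => ricci (G p.1) p.2) (J ×ˢ univ) (τ, y) := by
  have h1 := (ContinuousLinearMap.flipₗᵢ ℝ E E (E →L[ℝ] E)).contDiff (n := ∞)
      |>.contDiffAt.comp_contDiffWithinAt _ (contDiffWithinAt_riemann hτ hi h)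
  exact contDiffWithinAt_const.clm_comp (contDiffWithinAt_const.clm_comp h1)

theorem contDiffWithinAt_scalar (hτ : τ ∈ J) (hi : (G τ y).IsInvertible)
    (h : ContDiffWithinAt ℝ ∞ (fun p : ℝ × E => G p.1 p.2) (J ×ˢ univ) (τ, y)) :
    ContDiffWithinAt ℝ ∞ (fun p : ℝ × E => scalar (G p.1) p.2) (J ×ˢ univ) (τ, y) := by
  have h1 := (contDiffWithinAt_sharp hi h).clm_comp (contDiffWithinAt_ricci hτ hi h)
  exact (traceL E).contDiff.contDiffAt.comp_contDiffWithinAt _ h1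

theorem IsMetricAt.contDiffAt_christoffel {G : E → E →L[ℝ] E →L[ℝ] ℝ} (h : IsMetricAt G y) :
    ContDiffAt ℝ ∞ (christoffel G) y :=
  contDiffAt_of_joint (H := fun _ => christoffel G) (J := univ) (τ := 0) (mem_univ _)
    (contDiffWithinAt_christoffel (G := fun _ => G) (mem_univ _) h.isInvertible
      (h.smooth.comp_contDiffWithinAt (f := Prod.snd) _ contDiffWithinAt_snd))

end JointSmoothness

/-! ### Behaviour of the connection and the curvature under pullback. -/

section Pullback

variable {E : Type*} [NormedAddCommGroup E] [NormedSpace ℝ E]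
  {G G' : E → E →L[ℝ] E →L[ℝ] ℝ} {ψ : E → E} {y : E}

/-- Near `y`, the metric `G'` is the pullback of the metric `G` under the local
diffeomorphism `ψ`. -/
structure IsPullbackAt (G G' : E → E →L[ℝ] E →L[ℝ] ℝ) (ψ : E → E) (y : E) : Prop where
  target : IsMetricAt G (ψ y)
  source : IsMetricAt G' y
  smooth : ∀ᶠ z in 𝓝 y, ContDiffAt ℝ ∞ ψ z
  invertible : ∀ᶠ z in 𝓝 y, (fderiv ℝ ψ z).IsInvertible
  eq : ∀ᶠ z in 𝓝 y, ∀ u v, G' z u v = G (ψ z) (fderiv ℝ ψ z u) (fderiv ℝ ψ z v)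

theorem IsPullbackAt.eventually (h : IsPullbackAt G G' ψ y) :
    ∀ᶠ z in 𝓝 y, IsPullbackAt G G' ψ z := by
  filter_upwards [h.smooth.self_of_nhds.continuousAt.eventually h.target.eventually,
    h.source.eventually, h.smooth.eventually_nhds, h.invertible.eventually_nhds,
    h.eq.eventually_nhds] with z h1 h2 h3 h4 h5
  exact ⟨h1, h2, h3, h4, h5⟩

theorem IsPullbackAt.hasFDerivAt (h : IsPullbackAt G G' ψ y) :
    HasFDerivAt ψ (fderiv ℝ ψ y) y :=
  (h.smooth.self_of_nhds.differentiableAt (by simp)).hasFDerivAt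

theorem IsPullbackAt.contDiffAt_fderiv (h : IsPullbackAt G G' ψ y) :
    ContDiffAt ℝ ∞ (fderiv ℝ ψ) y :=
  h.smooth.self_of_nhds.fderiv_right (by simp)

theorem IsPullbackAt.hasFDerivAt_fderiv (h : IsPullbackAt G G' ψ y) :
    HasFDerivAt (fderiv ℝ ψ) (fderiv ℝ (fderiv ℝ ψ) y) y :=
  (h.contDiffAt_fderiv.differentiableAt (by simp)).hasFDerivAt

theorem IsPullbackAt.snd_symm (h : IsPullbackAt G G' ψ y) (u v : E) :
    fderiv ℝ (fderiv ℝ ψ) y u v = fderiv ℝ (fderiv ℝ ψ) y v u :=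
  (h.smooth.self_of_nhds.isSymmSndFDerivAt
    (by simpa using! WithTop.coe_le_coe.2 (le_top : (2 : ℕ∞) ≤ ⊤))).eq u v

theorem IsPullbackAt.fderiv_eq (h : IsPullbackAt G G' ψ y) (u v w : E) :
    fderiv ℝ G' y u v w =
      fderiv ℝ G (ψ y) (fderiv ℝ ψ y u) (fderiv ℝ ψ y v) (fderiv ℝ ψ y w)
        + G (ψ y) (fderiv ℝ (fderiv ℝ ψ) y u v) (fderiv ℝ ψ y w)
        + G (ψ y) (fderiv ℝ ψ y v) (fderiv ℝ (fderiv ℝ ψ) y u w) := by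
  have h1 := (h.source.differentiableAt.hasFDerivAt.clm_apply (hasFDerivAt_const v y)).clm_apply
    (hasFDerivAt_const w y)
  have h2 := ((h.target.differentiableAt.hasFDerivAt.comp y h.hasFDerivAt).clm_apply
    (h.hasFDerivAt_fderiv.clm_apply (hasFDerivAt_const v y))).clm_apply
    (h.hasFDerivAt_fderiv.clm_apply (hasFDerivAt_const w y))
  have h3 := h1.unique (h2.congr_of_eventuallyEq (h.eq.mono fun z hz => hz v w))
  have := congrArg (fun L : E →L[ℝ] ℝ => L u) h3
  simp at this
  rw [this]; ring

variable [FiniteDimensional ℝ E]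

/-- Pairing with the metric reduces this to `fderiv_eq` in the three index orders of the Koszul
formula; by symmetry of the second derivative of `ψ`, only one of its terms survives, the
inhomogeneous term. -/
theorem IsPullbackAt.christoffel_eq (h : IsPullbackAt G G' ψ y) (u v : E) :
    fderiv ℝ ψ y (christoffel G' y u v)
      = christoffel G (ψ y) (fderiv ℝ ψ y u) (fderiv ℝ ψ y v)
        + fderiv ℝ (fderiv ℝ ψ) y u v := by
  refine eq_of_apply_eq h.target.isInvertible fun w' => ?_
  obtain ⟨e, he⟩ := h.invertible.self_of_nhds
  obtain ⟨w, rfl⟩ : ∃ w, fderiv ℝ ψ y w = w' := ⟨e.symm w', by rw [← he]; simp⟩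
  have hs := h.target.symm.self_of_nhds
  rw [← h.eq.self_of_nhds, apply_christoffel h.source.isInvertible, map_add,
    add_apply, apply_christoffel h.target.isInvertible,
    h.fderiv_eq, h.fderiv_eq, h.fderiv_eq, h.snd_symm v u, h.snd_symm w u, h.snd_symm w v,
    hs (fderiv ℝ ψ y v) (fderiv ℝ (fderiv ℝ ψ) y u w)]
  rw [hs (fderiv ℝ ψ y u) (fderiv ℝ (fderiv ℝ ψ) y v w)]
  ring

/-- Differentiate the transformation law of the Christoffel symbols and antisymmetrise: the third
derivative of `ψ` drops out by symmetry, and the terms with second derivatives cancel against those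
produced by applying the law to the products of Christoffel symbols. -/
theorem IsPullbackAt.riemann_eq (h : IsPullbackAt G G' ψ y) (u v w : E) :
    fderiv ℝ ψ y (riemann G' y u v w)
      = riemann G (ψ y) (fderiv ℝ ψ y u) (fderiv ℝ ψ y v) (fderiv ℝ ψ y w) := by
  have hΓ' := (h.source.contDiffAt_christoffel.differentiableAt (by simp)).hasFDerivAt
  have hΓ := (h.target.contDiffAt_christoffel.differentiableAt (by simp)).hasFDerivAt
  have hD := h.hasFDerivAt_fderiv
  have hD2 : HasFDerivAt (fderiv ℝ (fderiv ℝ ψ)) (fderiv ℝ (fderiv ℝ (fderiv ℝ ψ)) y) y :=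
    ((h.contDiffAt_fderiv.fderiv_right (m := ∞) (by simp)).differentiableAt (by simp)).hasFDerivAt
  have key : ∀ u v : E,
      fderiv ℝ (fderiv ℝ ψ) y u (christoffel G' y v w)
        + fderiv ℝ ψ y (fderiv ℝ (christoffel G') y u v w)
      = fderiv ℝ (christoffel G) (ψ y) (fderiv ℝ ψ y u) (fderiv ℝ ψ y v) (fderiv ℝ ψ y w)
        + christoffel G (ψ y) (fderiv ℝ (fderiv ℝ ψ) y u v) (fderiv ℝ ψ y w)
        + christoffel G (ψ y) (fderiv ℝ ψ y v) (fderiv ℝ (fderiv ℝ ψ) y u w)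
        + fderiv ℝ (fderiv ℝ (fderiv ℝ ψ)) y u v w := by
    intro u v
    have h1 := hD.clm_apply ((hΓ'.clm_apply (hasFDerivAt_const v y)).clm_apply
      (hasFDerivAt_const w y))
    have h2 := (((hΓ.comp y h.hasFDerivAt).clm_apply
      (hD.clm_apply (hasFDerivAt_const v y))).clm_apply
      (hD.clm_apply (hasFDerivAt_const w y))).add
      ((hD2.clm_apply (hasFDerivAt_const v y)).clm_apply (hasFDerivAt_const w y))
    have h3 := h1.unique (h2.congr_of_eventuallyEq
      (h.eventually.mono fun z hz => hz.christoffel_eq v w))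
    have := congrArg (fun L : E →L[ℝ] E => L u) h3
    simp at this
    rw [add_comm, this]; abel
  have hsym3 : fderiv ℝ (fderiv ℝ (fderiv ℝ ψ)) y u v = fderiv ℝ (fderiv ℝ (fderiv ℝ ψ)) y v u :=
    (h.contDiffAt_fderiv.isSymmSndFDerivAt
    (by simpa using! WithTop.coe_le_coe.2 (le_top : (2 : ℕ∞) ≤ ⊤))).eq u v
  have e1 := key u v
  have e2 := key v u
  have e3 := h.christoffel_eq u (christoffel G' y v w)
  have e4 := h.christoffel_eq v (christoffel G' y u w)
  rw [h.christoffel_eq v w, map_add] at e3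
  rw [h.christoffel_eq u w, map_add] at e4
  rw [riemann_apply, riemann_apply, map_sub, map_add, map_sub, e3, e4]
  rw [h.snd_symm v u, ← hsym3] at e2
  rw [← eq_sub_iff_add_eq'] at e1 e2
  rw [e1, e2]
  abel

/-- By `riemann_eq` the derivative of `ψ` conjugates the two endomorphisms `w ↦ R(w, u)v`, and the
trace is invariant under conjugation. -/
theorem IsPullbackAt.ricci_eq (h : IsPullbackAt G G' ψ y) (u v : E) :
    ricci G' y u v = ricci G (ψ y) (fderiv ℝ ψ y u) (fderiv ℝ ψ y v) := by
  obtain ⟨e, he⟩ := h.invertible.self_of_nhds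
  rw [ricci_apply, ricci_apply, ← LinearMap.trace_conj' _ e.toLinearEquiv]
  congr 1
  ext w
  have := h.riemann_eq (e.symm w) u v
  rw [← he] at this ⊢
  simpa [LinearEquiv.conj_apply] using this

theorem IsPullbackAt.scalar_eq (h : IsPullbackAt G G' ψ y) :
    scalar G' y = scalar G (ψ y) := by
  obtain ⟨e, he⟩ := h.invertible.self_of_nhds
  have key : ∀ u, fderiv ℝ ψ y (ricciSharp G' y u) = ricciSharp G (ψ y) (fderiv ℝ ψ y u) := by
    intro u
    refine eq_of_apply_eq h.target.isInvertible fun w' => ?_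
    obtain ⟨w, rfl⟩ : ∃ w, fderiv ℝ ψ y w = w' := ⟨e.symm w', by rw [← he]; simp⟩
    rw [← h.eq.self_of_nhds, apply_ricciSharp h.source.isInvertible,
      apply_ricciSharp h.target.isInvertible, h.ricci_eq]
  rw [scalar, scalar, traceL_apply, traceL_apply, ← LinearMap.trace_conj' _ e.toLinearEquiv]
  congr 1
  ext w
  have := key (e.symm w)
  rw [← he] at this
  simpa [LinearEquiv.conj_apply] using this

end Pullback

/-! ### Directional derivatives on domains with boundary. -/

section DirectionalDerivative

/-- Domains on which derivatives are unique and second derivatives are symmetric up to the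
boundary. -/
structure IsRegularDomain {X : Type*} [NormedAddCommGroup X] [NormedSpace ℝ X] (S : Set X) :
    Prop where
  uniqueDiffOn : UniqueDiffOn ℝ S
  subset_closure : S ⊆ closure (interior S)

variable {X F F' : Type*} [NormedAddCommGroup X] [NormedSpace ℝ X]
  [NormedAddCommGroup F] [NormedSpace ℝ F] [NormedAddCommGroup F'] [NormedSpace ℝ F']

theorem _root_.Convex.isRegularDomain {S : Set X} (hc : Convex ℝ S) (hi : (interior S).Nonempty) :
    IsRegularDomain S :=
  ⟨uniqueDiffOn_convex hc hi,
    (hc.closure_interior_eq_closure_of_nonempty_interior hi).symm ▸ subset_closure⟩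

/-- The derivative of `f` at `p` in the direction `e`, within the domain `S`. -/
noncomputable def pd (S : Set X) (e : X) (f : X → F) (p : X) : F := fderivWithin ℝ f S p e

variable {S : Set X} {p e e' : X} {f h : X → F}

theorem _root_.ContDiffWithinAt.pd (hf : ContDiffWithinAt ℝ ∞ f S p) (hS : IsRegularDomain S)
    (hp : p ∈ S) (e : X) : ContDiffWithinAt ℝ ∞ (pd S e f) S p :=
  (hf.fderivWithin_right hS.uniqueDiffOn (by simp) hp).clm_apply contDiffWithinAt_const

theorem _root_.ContDiffWithinAt.hasFDerivWithinAt_infty (hf : ContDiffWithinAt ℝ ∞ f S p) :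
    HasFDerivWithinAt f (fderivWithin ℝ f S p) S p :=
  (hf.differentiableWithinAt (by simp)).hasFDerivWithinAt

theorem pd_eq (hS : IsRegularDomain S) (hp : p ∈ S) {L : X →L[ℝ] F}
    (hf : HasFDerivWithinAt f L S p) (e : X) : pd S e f p = L e := by
  rw [pd, hf.fderivWithin (hS.uniqueDiffOn p hp)]

theorem pd_congr (hp : p ∈ S) (hfh : f =ᶠ[𝓝[S] p] h) : pd S e f p = pd S e h p := by
  rw [pd, pd, hfh.fderivWithin_eq (hfh.self_of_nhdsWithin hp)]

theorem pd_add (hS : IsRegularDomain S) (hp : p ∈ S) (hf : ContDiffWithinAt ℝ ∞ f S p)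
    (hh : ContDiffWithinAt ℝ ∞ h S p) :
    pd S e (fun q => f q + h q) p = pd S e f p + pd S e h p :=
  pd_eq hS hp (hf.hasFDerivWithinAt_infty.add hh.hasFDerivWithinAt_infty) e

theorem pd_clm_apply {A : X → F →L[ℝ] F'} (hS : IsRegularDomain S) (hp : p ∈ S)
    (hA : ContDiffWithinAt ℝ ∞ A S p) (hf : ContDiffWithinAt ℝ ∞ f S p) :
    pd S e (fun q => A q (f q)) p = pd S e A p (f p) + A p (pd S e f p) := by
  rw [pd_eq hS hp (hA.hasFDerivWithinAt_infty.clm_apply hf.hasFDerivWithinAt_infty)]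
  simp [pd, add_comm]

theorem pd_const (c : F) : pd S e (fun _ => c) p = 0 := by
  simp [pd]

theorem pd_clm_apply_const {A : X → F →L[ℝ] F'} (hS : IsRegularDomain S) (hp : p ∈ S)
    (hA : ContDiffWithinAt ℝ ∞ A S p) (v : F) :
    pd S e (fun q => A q v) p = pd S e A p v := by
  rw [pd_clm_apply hS hp hA contDiffWithinAt_const, pd_const, map_zero, add_zero]

/-- Symmetry of second derivatives holds at points in the closure of the interior, hence also on the
edge `σ = 0` and at the ends of the time interval. -/
theorem pd_comm (hS : IsRegularDomain S) (hp : p ∈ S) (hf : ContDiffWithinAt ℝ ∞ f S p) :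
    pd S e (pd S e' f) p = pd S e' (pd S e f) p := by
  have hD : ContDiffWithinAt ℝ ∞ (fderivWithin ℝ f S) S p :=
    hf.fderivWithin_right hS.uniqueDiffOn (by simp) hp
  have h1 : ∀ v, pd S v (fderivWithin ℝ f S) p = fderivWithin ℝ (fderivWithin ℝ f S) S p v :=
    fun v => rfl
  change pd S e (fun q => fderivWithin ℝ f S q e') p = pd S e' (fun q => fderivWithin ℝ f S q e) p
  rw [pd_clm_apply_const hS hp hD, pd_clm_apply_const hS hp hD, h1, h1]
  exact (hf.isSymmSndFDerivWithinAt
    (by simpa using! WithTop.coe_le_coe.2 (le_top : (2 : ℕ∞) ≤ ⊤))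
    hS.uniqueDiffOn (hS.subset_closure hp) hp).eq e e'

end DirectionalDerivative

/-! ### Time-dependent functions and the substitution of `σ²` for time. -/

section TimeDependent

variable {E F : Type*} [NormedAddCommGroup E] [NormedSpace ℝ E]
  [NormedAddCommGroup F] [NormedSpace ℝ F] {J : Set ℝ} {H : ℝ → E → F} {τ : ℝ} {y : E}

theorem pd_time {H' : F} (hJ : UniqueDiffOn ℝ J)
    (hτ : τ ∈ J) (h : ContDiffWithinAt ℝ ∞ (fun p : ℝ × E => H p.1 p.2) (J ×ˢ univ) (τ, y))
    (hd : HasDerivWithinAt (fun r => H r y) H' J τ) :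
    pd (J ×ˢ univ) (1, 0) (fun p : ℝ × E => H p.1 p.2) (τ, y) = H' := by
  have h1 : HasFDerivWithinAt (fun r : ℝ => ((r, y) : ℝ × E)) (ContinuousLinearMap.inl ℝ ℝ E) J τ :=
    (hasFDerivAt_prodMk_left τ y).hasFDerivWithinAt
  have h2 := HasFDerivWithinAt.comp (t := J ×ˢ (univ : Set E)) (g := fun p : ℝ × E => H p.1 p.2) τ h.hasFDerivWithinAt_infty h1
    (fun r hr => ⟨hr, mem_univ _⟩)
  have h3 := (hJ τ hτ).eq h2 hd.hasFDerivWithinAt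
  have := congrArg (fun L : ℝ →L[ℝ] F => L 1) h3
  simpa [pd] using this

theorem pd_space (hτ : τ ∈ J)
    (h : ContDiffWithinAt ℝ ∞ (fun p : ℝ × E => H p.1 p.2) (J ×ˢ univ) (τ, y)) (u : E) :
    pd (J ×ˢ univ) (0, u) (fun p : ℝ × E => H p.1 p.2) (τ, y) = fderiv ℝ (H τ) y u := by
  have h1 : HasFDerivWithinAt (fun z : E => ((τ, z) : ℝ × E)) (ContinuousLinearMap.inr ℝ ℝ E)
    univ y := (hasFDerivAt_prodMk_right τ y).hasFDerivWithinAt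
  have h2 := HasFDerivWithinAt.comp (t := J ×ˢ (univ : Set E)) (g := fun p : ℝ × E => H p.1 p.2) y h.hasFDerivWithinAt_infty h1
    (fun r hr => ⟨hτ, mem_univ _⟩)
  have h3 := (hasFDerivWithinAt_univ.1 h2).fderiv
  have : fderiv ℝ (H τ) y = _ := h3
  rw [this]; simp [pd]

/-- The chain rule for the restriction of a time dependent function to a variation parametrized by
the square root of time. -/
theorem pd_comp_sq {S : Set (ℝ × ℝ)} {b : ℝ × ℝ → E} {p e : ℝ × ℝ} (hS : IsRegularDomain S)
    (hp : p ∈ S) (hSJ : ∀ q ∈ S, q.2 ^ 2 ∈ J)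
    (h : ContDiffWithinAt ℝ ∞ (fun p : ℝ × E => H p.1 p.2) (J ×ˢ univ) (p.2 ^ 2, b p))
    (hb : ContDiffWithinAt ℝ ∞ b S p) :
    pd S e (fun q => H (q.2 ^ 2) (b q)) p
      = (2 * p.2 * e.2) • pd (J ×ˢ univ) (1, 0) (fun p : ℝ × E => H p.1 p.2) (p.2 ^ 2, b p)
        + fderiv ℝ (H (p.2 ^ 2)) (b p) (pd S e b p) := by
  have h1 : HasFDerivWithinAt (fun q : ℝ × ℝ => (q.2 ^ 2, b q)) _ S p :=
    ((hasFDerivAt_snd (𝕜 := ℝ) (p := p)).pow 2).hasFDerivWithinAt.prodMk hb.hasFDerivWithinAt_infty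
  have h2 := HasFDerivWithinAt.comp (t := J ×ˢ (univ : Set E)) (g := fun p : ℝ × E => H p.1 p.2) p h.hasFDerivWithinAt_infty h1
    (fun q hq => ⟨hSJ q hq, mem_univ _⟩)
  have h3 := pd_eq hS hp h2 e
  refine Eq.trans h3 ?_
  rw [← pd_space (hSJ p hp) h, pd, pd, ← map_smul, ← map_add]
  simp [pd]

theorem contDiffWithinAt_comp_sq {S : Set (ℝ × ℝ)} {b : ℝ × ℝ → E} {p : ℝ × ℝ}
    (hSJ : ∀ q ∈ S, q.2 ^ 2 ∈ J)
    (h : ContDiffWithinAt ℝ ∞ (fun p : ℝ × E => H p.1 p.2) (J ×ˢ univ) (p.2 ^ 2, b p))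
    (hb : ContDiffWithinAt ℝ ∞ b S p) :
    ContDiffWithinAt ℝ ∞ (fun q => H (q.2 ^ 2) (b q)) S p :=
  ContDiffWithinAt.comp (t := J ×ˢ (univ : Set E)) (g := fun p : ℝ × E => H p.1 p.2) p h
    ((contDiffWithinAt_snd.pow 2).prodMk hb) (fun q hq => ⟨hSJ q hq, mem_univ _⟩)

end TimeDependent

/-! ### Evolution of the Christoffel symbols under the flow. -/

section Flow

variable {E : Type*} [NormedAddCommGroup E] [NormedSpace ℝ E] [FiniteDimensional ℝ E]

/-- `G r`, `r ∈ J`, is the coordinate expression on the open set `U` of a smooth solution of the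
backward Ricci flow. -/
structure IsFlowOn (G : ℝ → E → E →L[ℝ] E →L[ℝ] ℝ) (J : Set ℝ) (U : Set E) : Prop where
  isOpen : IsOpen U
  regular : IsRegularDomain (J ×ˢ (univ : Set E))
  uniqueDiffOn : UniqueDiffOn ℝ J
  smooth : ∀ τ ∈ J, ∀ y ∈ U,
    ContDiffWithinAt ℝ ∞ (fun p : ℝ × E => G p.1 p.2) (J ×ˢ univ) (τ, y)
  symm : ∀ τ ∈ J, ∀ y ∈ U, ∀ u v, G τ y u v = G τ y v u
  pos : ∀ τ ∈ J, ∀ y ∈ U, ∀ u, u ≠ 0 → 0 < G τ y u u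
  evolution : ∀ τ ∈ J, ∀ y ∈ U,
    HasDerivWithinAt (fun r => G r y) ((2 : ℝ) • ricci (G τ) y) J τ

namespace IsFlowOn

variable {G : ℝ → E → E →L[ℝ] E →L[ℝ] ℝ} {J : Set ℝ} {U : Set E} {τ : ℝ} {y : E}

theorem isMetricAt (h : IsFlowOn G J U) (hτ : τ ∈ J) (hy : y ∈ U) : IsMetricAt (G τ) y := by
  have hU := h.isOpen.mem_nhds hy
  exact ⟨mem_of_superset hU fun z hz => contDiffAt_of_joint hτ (h.smooth τ hτ z hz),
    mem_of_superset hU fun z hz => h.symm τ hτ z hz,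
    mem_of_superset hU fun z hz => h.pos τ hτ z hz⟩

theorem isInvertible (h : IsFlowOn G J U) (hτ : τ ∈ J) (hy : y ∈ U) : (G τ y).IsInvertible :=
  isInvertible_of_pos (h.pos τ hτ y hy)

theorem smooth_christoffel (h : IsFlowOn G J U) (hτ : τ ∈ J) (hy : y ∈ U) :
    ContDiffWithinAt ℝ ∞ (fun p : ℝ × E => christoffel (G p.1) p.2) (J ×ˢ univ) (τ, y) :=
  contDiffWithinAt_christoffel hτ (h.isInvertible hτ hy) (h.smooth τ hτ y hy)

theorem smooth_ricci (h : IsFlowOn G J U) (hτ : τ ∈ J) (hy : y ∈ U) :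
    ContDiffWithinAt ℝ ∞ (fun p : ℝ × E => ricci (G p.1) p.2) (J ×ˢ univ) (τ, y) :=
  contDiffWithinAt_ricci hτ (h.isInvertible hτ hy) (h.smooth τ hτ y hy)

theorem smooth_scalar (h : IsFlowOn G J U) (hτ : τ ∈ J) (hy : y ∈ U) :
    ContDiffWithinAt ℝ ∞ (fun p : ℝ × E => scalar (G p.1) p.2) (J ×ˢ univ) (τ, y) :=
  contDiffWithinAt_scalar hτ (h.isInvertible hτ hy) (h.smooth τ hτ y hy)

theorem pd_time_metric (h : IsFlowOn G J U) (hτ : τ ∈ J) (hy : y ∈ U) :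
    pd (J ×ˢ univ) (1, 0) (fun p : ℝ × E => G p.1 p.2) (τ, y) = (2 : ℝ) • ricci (G τ) y :=
  pd_time h.uniqueDiffOn hτ (h.smooth τ hτ y hy) (h.evolution τ hτ y hy)

/-- The Ricci tensor is symmetric, being half of the time derivative of the metric. -/
theorem ricci_symm (h : IsFlowOn G J U) (hτ : τ ∈ J) (hy : y ∈ U) (u v : E) :
    ricci (G τ) y u v = ricci (G τ) y v u := by
  have hd := h.evolution τ hτ y hy
  have h1 := (hd.clm_apply (hasDerivWithinAt_const τ J u)).clm_apply (hasDerivWithinAt_const τ J v)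
  have h2 := (hd.clm_apply (hasDerivWithinAt_const τ J v)).clm_apply (hasDerivWithinAt_const τ J u)
  have h3 := (h.uniqueDiffOn τ hτ).eq_deriv _ h1
    (h2.congr_of_mem (fun r hr => h.symm r hr y hy u v) hτ)
  simpa using h3

theorem mem_nhdsWithin (h : IsFlowOn G J U) (hy : y ∈ U) :
    J ×ˢ U ∈ 𝓝[J ×ˢ univ] ((τ, y) : ℝ × E) := by
  have : (univ : Set ℝ) ×ˢ U ∈ 𝓝 ((τ, y) : ℝ × E) :=
    prod_mem_nhds univ_mem (h.isOpen.mem_nhds hy)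
  filter_upwards [self_mem_nhdsWithin, mem_nhdsWithin_of_mem_nhds this] with q h1 h2
  exact ⟨h1.1, h2.2⟩

/-- Time and space derivatives of the metric commute. -/
theorem pd_time_fderiv (h : IsFlowOn G J U) (hτ : τ ∈ J) (hy : y ∈ U) (u : E) :
    pd (J ×ˢ univ) (1, 0) (fun p : ℝ × E => fderiv ℝ (G p.1) p.2 u) (τ, y)
      = (2 : ℝ) • fderiv ℝ (ricci (G τ)) y u := by
  have hp : ((τ, y) : ℝ × E) ∈ J ×ˢ (univ : Set E) := ⟨hτ, mem_univ _⟩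
  have h1 : (fun p : ℝ × E => fderiv ℝ (G p.1) p.2 u) =ᶠ[𝓝[J ×ˢ univ] (τ, y)]
      pd (J ×ˢ univ) (0, u) (fun p : ℝ × E => G p.1 p.2) := by
    filter_upwards [h.mem_nhdsWithin hy] with q hq
    exact (pd_space hq.1 (h.smooth _ hq.1 _ hq.2) u).symm
  have h2 : pd (J ×ˢ univ) (1, 0) (fun p : ℝ × E => G p.1 p.2) =ᶠ[𝓝[J ×ˢ univ] (τ, y)]
      fun p : ℝ × E => (fun r z => (2 : ℝ) • ricci (G r) z) p.1 p.2 := by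
    filter_upwards [h.mem_nhdsWithin hy] with q hq
    exact h.pd_time_metric hq.1 hq.2
  have hR := h.smooth_ricci hτ hy
  rw [pd_congr hp h1, pd_comm h.regular hp (h.smooth τ hτ y hy), pd_congr hp h2,
    
    pd_space (H := fun r z => (2 : ℝ) • ricci (G r) z) hτ (hR.const_smul (2 : ℝ))]
  have h3 := ((contDiffAt_of_joint (H := fun r => ricci (G r)) hτ hR).differentiableAt
    (by simp)).hasFDerivAt.const_smul (2 : ℝ)
  exact congrArg (fun L : E →L[ℝ] E →L[ℝ] E →L[ℝ] ℝ => L u) h3.fderiv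

/-- The time derivative of the Christoffel symbols. -/
noncomputable def christoffelDot (G : ℝ → E → E →L[ℝ] E →L[ℝ] ℝ) (J : Set ℝ) (τ : ℝ) (y : E) :
    E →L[ℝ] E →L[ℝ] E :=
  pd (J ×ˢ univ) (1, 0) (fun p : ℝ × E => christoffel (G p.1) p.2) (τ, y)

/-- Differentiate in time the identity expressing `G(Γ(u, v), w)` through first derivatives of `G`,
using `∂_τ G = 2 Ric`. By symmetry of Ric, the right-hand side is `(∇_u Ric)(v, w) + (∇_v Ric)(u, w)
- (∇_w Ric)(u, v)`, whose Christoffel corrections collapse to the last term. -/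
theorem apply_christoffelDot (h : IsFlowOn G J U) (hτ : τ ∈ J) (hy : y ∈ U) (u v w : E) :
    G τ y (christoffelDot G J τ y u v) w = fderiv ℝ (ricci (G τ)) y u v w
      + fderiv ℝ (ricci (G τ)) y v u w - fderiv ℝ (ricci (G τ)) y w u v
      - 2 * ricci (G τ) y (christoffel (G τ) y u v) w := by
  have hp : ((τ, y) : ℝ × E) ∈ J ×ˢ (univ : Set E) := ⟨hτ, mem_univ _⟩
  have hG := h.smooth τ hτ y hy
  have hΓ := h.smooth_christoffel hτ hy
  have hD : ∀ u : E, ContDiffWithinAt ℝ ∞ (fun p : ℝ × E => fderiv ℝ (G p.1) p.2 u)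
      (J ×ˢ univ) (τ, y) := fun u =>
    (contDiffWithinAt_partial_fderiv hτ hG).clm_apply contDiffWithinAt_const
  have hDuv : ∀ u v w : E, HasFDerivWithinAt (fun p : ℝ × E => fderiv ℝ (G p.1) p.2 u v w) _
      (J ×ˢ univ) (τ, y) := fun u v w =>
    (((hD u).hasFDerivWithinAt_infty.clm_apply (hasFDerivWithinAt_const v _ _)).clm_apply
      (hasFDerivWithinAt_const w _ _))
  have hL := (hG.hasFDerivWithinAt_infty.clm_apply
    ((hΓ.hasFDerivWithinAt_infty.clm_apply (hasFDerivWithinAt_const u _ _)).clm_apply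
      (hasFDerivWithinAt_const v _ _))).clm_apply (hasFDerivWithinAt_const w _ _)
  have hR := (((hDuv u v w).add (hDuv v u w)).sub (hDuv w u v)).const_mul (1 / 2 : ℝ)
  have hev : (fun p : ℝ × E => G p.1 p.2 (christoffel (G p.1) p.2 u v) w)
      =ᶠ[𝓝[J ×ˢ univ] (τ, y)] fun p : ℝ × E => (1 / 2 : ℝ) * (fderiv ℝ (G p.1) p.2 u v w
        + fderiv ℝ (G p.1) p.2 v u w - fderiv ℝ (G p.1) p.2 w u v) := by
    filter_upwards [h.mem_nhdsWithin hy] with q hq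
    rw [apply_christoffel (h.isInvertible hq.1 hq.2)]; ring
  have h1 := pd_congr (e := ((1, 0) : ℝ × E)) hp hev
  have e1 := pd_eq h.regular hp hL (1, 0)
  have e2 := pd_eq h.regular hp hR (1, 0)
  have h2 := e1.symm.trans (h1.trans e2)
  have k1 := h.pd_time_metric hτ hy
  have k2 := fun u => h.pd_time_fderiv hτ hy u
  simp only [pd] at k1 k2
  simp [k1, k2] at h2
  rw [christoffelDot, pd]
  linarith

end IsFlowOn

end Flow

/-! ### Covariant calculus along a variation and the pointwise second variation. -/

section CoordinateVariation

variable {E : Type*} [NormedAddCommGroup E] [NormedSpace ℝ E]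

/-- On the part `O` of the domain `S`, the map `b` is the coordinate expression, with values in `U`,
of a smooth variation parametrized by the square root of time. -/
structure IsVariationOn (J : Set ℝ) (U : Set E) (S O : Set (ℝ × ℝ)) (b : ℝ × ℝ → E) : Prop where
  regular : IsRegularDomain S
  subset : O ⊆ S
  mem_nhdsWithin : ∀ q ∈ O, O ∈ 𝓝[S] q
  time : ∀ q ∈ S, q.2 ^ 2 ∈ J
  maps : ∀ q ∈ O, b q ∈ U
  smooth : ∀ q ∈ O, ContDiffWithinAt ℝ ∞ b S q

/-- The covariant derivative, in coordinates, of the field `v` along the map `b`, in the parameter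
direction `e`. -/
noncomputable def covD (G : ℝ → E → E →L[ℝ] E →L[ℝ] ℝ) (S : Set (ℝ × ℝ)) (b : ℝ × ℝ → E)
    (e : ℝ × ℝ) (v : ℝ × ℝ → E) (q : ℝ × ℝ) : E :=
  pd S e v q + christoffel (G (q.2 ^ 2)) (b q) (pd S e b q) (v q)

theorem IsVariationOn.smooth_pd {J : Set ℝ} {U : Set E} {S O : Set (ℝ × ℝ)} {b : ℝ × ℝ → E}
    {p : ℝ × ℝ} (hb : IsVariationOn J U S O b) (hp : p ∈ O) (e : ℝ × ℝ) :
    ContDiffWithinAt ℝ ∞ (pd S e b) S p :=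
  (hb.smooth p hp).pd hb.regular (hb.subset hp) e

variable [FiniteDimensional ℝ E] {G : ℝ → E → E →L[ℝ] E →L[ℝ] ℝ} {J : Set ℝ} {U : Set E}
  {S O : Set (ℝ × ℝ)} {b : ℝ × ℝ → E} {p e e' : ℝ × ℝ} {v w : ℝ × ℝ → E}

namespace IsVariationOn

theorem smooth_metric (hb : IsVariationOn J U S O b) (hG : IsFlowOn G J U) (hp : p ∈ O) :
    ContDiffWithinAt ℝ ∞ (fun q => G (q.2 ^ 2) (b q)) S p :=
  contDiffWithinAt_comp_sq hb.time
    (hG.smooth _ (hb.time p (hb.subset hp)) _ (hb.maps p hp)) (hb.smooth p hp)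

theorem smooth_christoffel (hb : IsVariationOn J U S O b) (hG : IsFlowOn G J U) (hp : p ∈ O) :
    ContDiffWithinAt ℝ ∞ (fun q => christoffel (G (q.2 ^ 2)) (b q)) S p :=
  contDiffWithinAt_comp_sq (H := fun r => christoffel (G r)) hb.time
    (hG.smooth_christoffel (hb.time p (hb.subset hp)) (hb.maps p hp)) (hb.smooth p hp)

theorem smooth_ricci (hb : IsVariationOn J U S O b) (hG : IsFlowOn G J U) (hp : p ∈ O) :
    ContDiffWithinAt ℝ ∞ (fun q => ricci (G (q.2 ^ 2)) (b q)) S p :=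
  contDiffWithinAt_comp_sq (H := fun r => ricci (G r)) hb.time
    (hG.smooth_ricci (hb.time p (hb.subset hp)) (hb.maps p hp)) (hb.smooth p hp)

theorem smooth_scalar (hb : IsVariationOn J U S O b) (hG : IsFlowOn G J U) (hp : p ∈ O) :
    ContDiffWithinAt ℝ ∞ (fun q => scalar (G (q.2 ^ 2)) (b q)) S p :=
  contDiffWithinAt_comp_sq (H := fun r => scalar (G r)) hb.time
    (hG.smooth_scalar (hb.time p (hb.subset hp)) (hb.maps p hp)) (hb.smooth p hp)

theorem smooth_covD (hb : IsVariationOn J U S O b) (hG : IsFlowOn G J U) (hp : p ∈ O)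
    (hv : ContDiffWithinAt ℝ ∞ v S p) (e : ℝ × ℝ) : ContDiffWithinAt ℝ ∞ (covD G S b e v) S p :=
  (hv.pd hb.regular (hb.subset hp) e).add
    (((hb.smooth_christoffel hG hp).clm_apply (hb.smooth_pd hp e)).clm_apply hv)

theorem smooth_inner (hb : IsVariationOn J U S O b) (hG : IsFlowOn G J U) (hp : p ∈ O)
    (hv : ContDiffWithinAt ℝ ∞ v S p) (hw : ContDiffWithinAt ℝ ∞ w S p) :
    ContDiffWithinAt ℝ ∞ (fun q => G (q.2 ^ 2) (b q) (v q) (w q)) S p :=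
  ((hb.smooth_metric hG hp).clm_apply hv).clm_apply hw

/-- Product rule for the evolving metric. -/
theorem pd_inner (hb : IsVariationOn J U S O b) (hG : IsFlowOn G J U) (hp : p ∈ O)
    (hv : ContDiffWithinAt ℝ ∞ v S p) (hw : ContDiffWithinAt ℝ ∞ w S p) (e : ℝ × ℝ) :
    pd S e (fun q => G (q.2 ^ 2) (b q) (v q) (w q)) p
      = G (p.2 ^ 2) (b p) (covD G S b e v p) (w p) + G (p.2 ^ 2) (b p) (v p) (covD G S b e w p)
        + 4 * p.2 * e.2 * ricci (G (p.2 ^ 2)) (b p) (v p) (w p) := by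
  have hpS := hb.subset hp
  have hτ := hb.time p hpS
  have hy := hb.maps p hp
  have hm := hb.smooth_metric hG hp
  rw [pd_clm_apply hb.regular hpS (hm.clm_apply hv) hw, pd_clm_apply hb.regular hpS hm hv,
    pd_comp_sq hb.regular hpS hb.time (hG.smooth _ hτ _ hy) (hb.smooth p hp),
    hG.pd_time_metric hτ hy]
  simp only [add_apply, smul_apply, (hG.isMetricAt hτ hy).fderiv_apply, covD, map_add, smul_eq_mul]
  ring

/-- Torsion-freeness: partial derivatives commute and the Christoffel symbols are symmetric. -/
theorem covD_comm (hb : IsVariationOn J U S O b) (hG : IsFlowOn G J U) (hp : p ∈ O)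
    (e e' : ℝ × ℝ) : covD G S b e (pd S e' b) p = covD G S b e' (pd S e b) p := by
  rw [covD, covD, pd_comm hb.regular (hb.subset hp) (hb.smooth p hp),
    (hG.isMetricAt (hb.time p (hb.subset hp)) (hb.maps p hp)).christoffel_symm]

/-- In the commutator the mixed partials of `v` and of `b` cancel and the Christoffel terms assemble
into the curvature. The connection at `q` belongs to time `q.2 ^ 2`, so a step in the direction `e`
also moves it at the rate `2 * p.2 * e.2`. -/
theorem covD_covD (hb : IsVariationOn J U S O b) (hG : IsFlowOn G J U) (hp : p ∈ O)
    (hv : ContDiffWithinAt ℝ ∞ v S p) (e e' : ℝ × ℝ) :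
    covD G S b e (covD G S b e' v) p = covD G S b e' (covD G S b e v) p
      + riemann (G (p.2 ^ 2)) (b p) (pd S e b p) (pd S e' b p) (v p)
      + (2 * p.2 * e.2) • IsFlowOn.christoffelDot G J (p.2 ^ 2) (b p) (pd S e' b p) (v p)
      - (2 * p.2 * e'.2) • IsFlowOn.christoffelDot G J (p.2 ^ 2) (b p) (pd S e b p) (v p) := by
  have hpS := hb.subset hp
  have hτ := hb.time p hpS
  have hy := hb.maps p hp
  have hΓ := hb.smooth_christoffel hG hp
  have key : ∀ e e' : ℝ × ℝ, covD G S b e (covD G S b e' v) p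
      = pd S e (pd S e' v) p
        + ((2 * p.2 * e.2) • IsFlowOn.christoffelDot G J (p.2 ^ 2) (b p) (pd S e' b p) (v p)
        + fderiv ℝ (christoffel (G (p.2 ^ 2))) (b p) (pd S e b p) (pd S e' b p) (v p)
        + christoffel (G (p.2 ^ 2)) (b p) (pd S e (pd S e' b) p) (v p)
        + christoffel (G (p.2 ^ 2)) (b p) (pd S e' b p) (pd S e v p))
        + (christoffel (G (p.2 ^ 2)) (b p) (pd S e b p) (pd S e' v p)
          + christoffel (G (p.2 ^ 2)) (b p) (pd S e b p)
            (christoffel (G (p.2 ^ 2)) (b p) (pd S e' b p) (v p))) := by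
    intro e e'
    have h1 : pd S e (covD G S b e' v) p = pd S e (pd S e' v) p + pd S e
        (fun q => christoffel (G (q.2 ^ 2)) (b q) (pd S e' b q) (v q)) p :=
      pd_add hb.regular hpS (hv.pd hb.regular hpS e')
        ((hΓ.clm_apply (hb.smooth_pd hp e')).clm_apply hv)
    rw [covD, h1, pd_clm_apply hb.regular hpS (hΓ.clm_apply (hb.smooth_pd hp e')) hv,
      pd_clm_apply hb.regular hpS hΓ (hb.smooth_pd hp e'),
      pd_comp_sq (H := fun r => christoffel (G r)) hb.regular hpS hb.time
        (hG.smooth_christoffel hτ hy) (hb.smooth p hp)]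
    simp only [add_apply, smul_apply, covD, map_add, IsFlowOn.christoffelDot]
  rw [key e e', key e' e, pd_comm hb.regular hpS hv, pd_comm hb.regular hpS (hb.smooth p hp),
    riemann_apply]
  abel

end IsVariationOn

/-- The direction of the variation parameter. -/
abbrev e₁ : ℝ × ℝ := (1, 0)

/-- The direction of the time parameter. -/
abbrev e₂ : ℝ × ℝ := (0, 1)

namespace IsVariationOn

/-- The boundary term `⟨∇_Y Y, V⟩` in terms of derivatives of inner products. -/
theorem inner_covD (hb : IsVariationOn J U S O b) (hG : IsFlowOn G J U) (hp : p ∈ O) :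
    pd S e₁ (fun q => G (q.2 ^ 2) (b q) (pd S e₁ b q) (pd S e₂ b q)) p
      - 1 / 2 * pd S e₂ (fun q => G (q.2 ^ 2) (b q) (pd S e₁ b q) (pd S e₁ b q)) p
      + 2 * p.2 * ricci (G (p.2 ^ 2)) (b p) (pd S e₁ b p) (pd S e₁ b p)
    = G (p.2 ^ 2) (b p) (covD G S b e₁ (pd S e₁ b) p) (pd S e₂ b p) := by
  have hτ := hb.time p (hb.subset hp)
  have hy := hb.maps p hp
  rw [hb.pd_inner hG hp (hb.smooth_pd hp e₁) (hb.smooth_pd hp e₂),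
    hb.pd_inner hG hp (hb.smooth_pd hp e₁) (hb.smooth_pd hp e₁), hb.covD_comm hG hp e₁ e₂,
    hG.symm _ hτ _ hy (covD G S b e₂ (pd S e₁ b) p)]
  simp only
  ring

/-- The `ℒ`-length integrand in the square root of time. -/
theorem pd_energy (hb : IsVariationOn J U S O b) (hG : IsFlowOn G J U) (hp : p ∈ O) :
    pd S e₁ (fun q => 2 * q.2 ^ 2 * scalar (G (q.2 ^ 2)) (b q)
      + 1 / 2 * G (q.2 ^ 2) (b q) (pd S e₂ b q) (pd S e₂ b q)) p
    = 2 * p.2 ^ 2 * fderiv ℝ (scalar (G (p.2 ^ 2))) (b p) (pd S e₁ b p)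
      + G (p.2 ^ 2) (b p) (covD G S b e₂ (pd S e₁ b) p) (pd S e₂ b p) := by
  have hpS := hb.subset hp
  have hτ := hb.time p hpS
  have hy := hb.maps p hp
  have h1 := (((hasFDerivAt_snd (𝕜 := ℝ) (p := p)).pow 2).const_mul 2).hasFDerivWithinAt (s := S)
  have h2 := h1.mul (hb.smooth_scalar hG hp).hasFDerivWithinAt_infty
  have h3 := (hb.smooth_inner hG hp (hb.smooth_pd hp e₂) (hb.smooth_pd hp e₂)).hasFDerivWithinAt_infty
  have h4 := pd_eq hb.regular hpS (h2.add (h3.const_mul (1 / 2))) e₁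
  have h5 := pd_comp_sq (H := fun r => scalar (G r)) (e := e₁) hb.regular hpS hb.time
    (hG.smooth_scalar hτ hy) (hb.smooth p hp)
  have h6 := hb.pd_inner hG hp (hb.smooth_pd hp e₂) (hb.smooth_pd hp e₂) e₁
  refine Eq.trans h4 ?_
  rw [hb.covD_comm hG hp e₁ e₂,
    hG.symm _ hτ _ hy _ (covD G S b e₂ (pd S e₁ b) p)] at h6
  rw [pd] at h5 h6
  simp at h5 h6
  simp [h5, h6]
  ring

/-- The heart of the computation. Up to the exact derivative `∂_σ⟨∇_Y Y, V⟩`, the second derivative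
of the density contains only tensorial terms in `Y`, `V` and `∇_V Y`; the geodesic equation is
needed just at the point `p`. -/
theorem pd_pd_energy (hb : IsVariationOn J U S O b) (hG : IsFlowOn G J U) (hp : p ∈ O)
    (hgeo : covD G S b e₂ (pd S e₂ b) p = (2 * p.2 ^ 2) •
      gradient (G (p.2 ^ 2)) (scalar (G (p.2 ^ 2))) (b p)
      - (4 * p.2) • ricciSharp (G (p.2 ^ 2)) (b p) (pd S e₂ b p)) :
    pd S e₁ (pd S e₁ (fun q => 2 * q.2 ^ 2 * scalar (G (q.2 ^ 2)) (b q)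
      + 1 / 2 * G (q.2 ^ 2) (b q) (pd S e₂ b q) (pd S e₂ b q))) p
    = pd S e₂ (fun q => G (q.2 ^ 2) (b q) (covD G S b e₁ (pd S e₁ b) q) (pd S e₂ b q)) p
      + 2 * p.2 ^ 2 * hessian (G (p.2 ^ 2)) (scalar (G (p.2 ^ 2))) (b p) (pd S e₁ b p)
        (pd S e₁ b p)
      + G (p.2 ^ 2) (b p) (covD G S b e₂ (pd S e₁ b) p) (covD G S b e₂ (pd S e₁ b) p)
      + G (p.2 ^ 2) (b p) (riemann (G (p.2 ^ 2)) (b p) (pd S e₁ b p) (pd S e₂ b p) (pd S e₁ b p))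
        (pd S e₂ b p)
      + 2 * p.2 * nablaRicci (G (p.2 ^ 2)) (b p) (pd S e₂ b p) (pd S e₁ b p) (pd S e₁ b p)
      - 4 * p.2 * nablaRicci (G (p.2 ^ 2)) (b p) (pd S e₁ b p) (pd S e₁ b p) (pd S e₂ b p) := by
  have hpS := hb.subset hp
  have hτ := hb.time p hpS
  have hy := hb.maps p hp
  have hM := hG.isMetricAt hτ hy
  have hY := hb.smooth_pd hp e₁
  have hV := hb.smooth_pd hp e₂
  have hN := hb.smooth_covD hG hp hY e₂
  have hK := hb.smooth_covD hG hp hY e₁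
  have hev : pd S e₁ (fun q => 2 * q.2 ^ 2 * scalar (G (q.2 ^ 2)) (b q)
      + 1 / 2 * G (q.2 ^ 2) (b q) (pd S e₂ b q) (pd S e₂ b q)) =ᶠ[𝓝[S] p]
      fun q => 2 * q.2 ^ 2 * fderiv ℝ (scalar (G (q.2 ^ 2))) (b q) (pd S e₁ b q)
        + G (q.2 ^ 2) (b q) (covD G S b e₂ (pd S e₁ b) q) (pd S e₂ b q) := by
    filter_upwards [hb.mem_nhdsWithin p hp] with q hq
    exact hb.pd_energy hG hq
  have hdR := contDiffWithinAt_partial_fderiv (H := fun r => scalar (G r)) hτ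
    (hG.smooth_scalar hτ hy)
  have hdRb := contDiffWithinAt_comp_sq (H := fun r => fderiv ℝ (scalar (G r))) hb.time hdR
    (hb.smooth p hp)
  have h1 := (((hasFDerivAt_snd (𝕜 := ℝ) (p := p)).pow 2).const_mul 2).hasFDerivWithinAt (s := S)
  have h2 := h1.mul (hdRb.clm_apply hY).hasFDerivWithinAt_infty
  have h3 := (hb.smooth_inner hG hp hN hV).hasFDerivWithinAt_infty
  have h4 := pd_eq hb.regular hpS (h2.add h3) e₁
  have h5 := pd_clm_apply (e := e₁) hb.regular hpS hdRb hY
  rw [pd_comp_sq (H := fun r => fderiv ℝ (scalar (G r))) (e := e₁) hb.regular hpS hb.time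
    hdR (hb.smooth p hp)] at h5
  have h6 := hb.pd_inner hG hp hN hV e₁
  have h7 := hb.pd_inner hG hp hK hV e₂
  have h8 := hb.covD_covD hG hp hY e₁ e₂
  have hKv : covD G S b e₁ (pd S e₁ b) p = pd S e₁ (pd S e₁ b) p +
    christoffel (G (p.2 ^ 2)) (b p) (pd S e₁ b p) (pd S e₁ b p) := rfl
  have h9 : fderiv ℝ (scalar (G (p.2 ^ 2))) (b p) (covD G S b e₁ (pd S e₁ b) p)
      = fderiv ℝ (scalar (G (p.2 ^ 2))) (b p) (pd S e₁ (pd S e₁ b) p)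
        + fderiv ℝ (scalar (G (p.2 ^ 2))) (b p)
          (christoffel (G (p.2 ^ 2)) (b p) (pd S e₁ b p) (pd S e₁ b p)) := by
    rw [hKv, map_add]
  have h10 := hG.apply_christoffelDot hτ hy (pd S e₁ b p) (pd S e₁ b p) (pd S e₂ b p)
  -- The only use of the geodesic equation. Its gradient part matches the `dR(∇_Y Y)` left over from
  -- the Hessian, and its Ricci part cancels the `4σ Ric(∇_Y Y, V)` that `h7` gets from the evolving
  -- metric.
  have h11 : G (p.2 ^ 2) (b p) (covD G S b e₁ (pd S e₁ b) p) (covD G S b e₂ (pd S e₂ b) p)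
      = 2 * p.2 ^ 2 * fderiv ℝ (scalar (G (p.2 ^ 2))) (b p) (covD G S b e₁ (pd S e₁ b) p)
        - 4 * p.2 * ricci (G (p.2 ^ 2)) (b p) (covD G S b e₁ (pd S e₁ b) p) (pd S e₂ b p) := by
    rw [hG.symm _ hτ _ hy, hgeo, map_sub, map_smul, map_smul, sub_apply, smul_apply, smul_apply,
      apply_gradient hM.isInvertible, apply_ricciSharp hM.isInvertible, hG.ricci_symm hτ hy]
    rfl
  have hΓs := hM.christoffel_symm (pd S e₂ b p) (pd S e₁ b p)
  have hRs := hG.ricci_symm hτ hy (pd S e₁ b p)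
    (christoffel (G (p.2 ^ 2)) (b p) (pd S e₁ b p) (pd S e₂ b p))
  rw [pd_congr hpS hev]
  refine Eq.trans h4 ?_
  rw [h7, h11]
  rw [hb.covD_comm hG hp e₁ e₂, h8] at h6
  rw [pd] at h5 h6
  simp only [hessian, nablaRicci, hΓs, hRs]
  simp at h5 h6
  simp [h5, h6, h10, h9]
  ring

end IsVariationOn

end CoordinateVariation

/-! ### Charts, transition maps and the metric in a chart. -/

section Charts

variable {n : ℕ} {M : Type*} [TopologicalSpace M] [ChartedSpace (EuclideanSpace ℝ (Fin n)) M]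

local notation "𝔼" => EuclideanSpace ℝ (Fin n)

/-- The derivative at `x` of the chart around `c`. -/
noncomputable def chartDeriv (c x : M) : 𝔼 →L[ℝ] 𝔼 :=
  mfderiv (𝓡 n) 𝓘(ℝ, EuclideanSpace ℝ (Fin n)) (extChartAt (𝓡 n) c) x

/-- The derivative at `y` of the inverse of the chart around `c`. -/
noncomputable def chartSymmDeriv (c : M) (y : 𝔼) : 𝔼 →L[ℝ] 𝔼 :=
  mfderiv 𝓘(ℝ, EuclideanSpace ℝ (Fin n)) (𝓡 n) (extChartAt (𝓡 n) c).symm y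

theorem isOpen_target (c : M) : IsOpen (extChartAt (𝓡 n) c).target := isOpen_extChartAt_target c

/-- The domain of the transition map is open. -/
theorem eventually_mem_source {c c' : M} {y : 𝔼} (hy : y ∈ (extChartAt (𝓡 n) c).target)
    (hy' : (extChartAt (𝓡 n) c).symm y ∈ (extChartAt (𝓡 n) c').source) :
    ∀ᶠ z in 𝓝 y, z ∈ (extChartAt (𝓡 n) c).target ∧
      (extChartAt (𝓡 n) c).symm z ∈ (extChartAt (𝓡 n) c').source := by
  have hc : ContinuousAt (extChartAt (𝓡 n) c).symm y := continuousAt_extChartAt_symm'' hy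
  exact Filter.Eventually.and ((isOpen_target c).mem_nhds hy)
    (hc ((isOpen_extChartAt_source (I := 𝓡 n) c').mem_nhds hy'))

variable [IsManifold (𝓡 n) ∞ M]

/-- The inner product at `x`, as a bilinear form on coordinate vectors. -/
def Metric.form (g : Metric n M) (x : M) : 𝔼 →L[ℝ] 𝔼 →L[ℝ] ℝ := g.inner x

theorem Metric.coord_eq_form (g : Metric n M) (c : M) (y u v : 𝔼) :
    g.coord c y u v = g.form ((extChartAt (𝓡 n) c).symm y) (chartSymmDeriv c y u)
      (chartSymmDeriv c y v) := rfl

theorem isManifold_one : IsManifold (𝓡 n) 1 M := IsManifold.of_le (n := ∞) (by simp)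

theorem chartDeriv_self (x : M) : chartDeriv x x = ContinuousLinearMap.id ℝ 𝔼 := by
  have : IsManifold (𝓡 n) 1 M := isManifold_one
  exact mfderiv_extChartAt_self

theorem chartSymmDeriv_chartDeriv {c x : M} (hx : x ∈ (extChartAt (𝓡 n) c).source) (u : 𝔼) :
    chartSymmDeriv c (extChartAt (𝓡 n) c x) (chartDeriv c x u) = u := by
  have : IsManifold (𝓡 n) 1 M := isManifold_one
  have h := mfderivWithin_extChartAt_symm_comp_mfderiv_extChartAt' (I := 𝓡 n) hx
  rw [ModelWithCorners.range_eq_univ, mfderivWithin_univ] at h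
  exact congrArg (fun L : 𝔼 →L[ℝ] 𝔼 => L u) h

theorem chartDeriv_chartSymmDeriv {c : M} {y : 𝔼} (hy : y ∈ (extChartAt (𝓡 n) c).target) (u : 𝔼) :
    chartDeriv c ((extChartAt (𝓡 n) c).symm y) (chartSymmDeriv c y u) = u := by
  have : IsManifold (𝓡 n) 1 M := isManifold_one
  have h := mfderiv_extChartAt_comp_mfderivWithin_extChartAt_symm (I := 𝓡 n) hy
  rw [ModelWithCorners.range_eq_univ, mfderivWithin_univ] at h
  exact congrArg (fun L : 𝔼 →L[ℝ] 𝔼 => L u) h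

theorem Metric.form_eq_coord (g : Metric n M) {c x : M} (hx : x ∈ (extChartAt (𝓡 n) c).source)
    (u v : 𝔼) : g.form x u v
      = g.coord c (extChartAt (𝓡 n) c x) (chartDeriv c x u) (chartDeriv c x v) := by
  rw [g.coord_eq_form, chartSymmDeriv_chartDeriv hx, chartSymmDeriv_chartDeriv hx,
    (extChartAt (𝓡 n) c).left_inv hx]

/-- The chart transition from the chart around `c` to the chart around `c'`. -/
noncomputable def transition (c c' : M) : 𝔼 → 𝔼 :=
  extChartAt (𝓡 n) c' ∘ (extChartAt (𝓡 n) c).symm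

theorem mdifferentiableAt_extChartAt_symm {c : M} {y : 𝔼}
    (hy : y ∈ (extChartAt (𝓡 n) c).target) :
    MDifferentiableAt 𝓘(ℝ, 𝔼) (𝓡 n) (extChartAt (𝓡 n) c).symm y := by
  have : IsManifold (𝓡 n) 1 M := isManifold_one
  have h := mdifferentiableWithinAt_extChartAt_symm (I := 𝓡 n) hy
  rwa [ModelWithCorners.range_eq_univ, mdifferentiableWithinAt_univ] at h

theorem mdifferentiableAt_chart {c x : M} (hx : x ∈ (extChartAt (𝓡 n) c).source) :
    MDifferentiableAt (𝓡 n) 𝓘(ℝ, 𝔼) (extChartAt (𝓡 n) c) x := by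
  have : IsManifold (𝓡 n) 1 M := isManifold_one
  exact mdifferentiableAt_extChartAt (by simpa using hx)

theorem fderiv_transition {c c' : M} {y : 𝔼} (hy : y ∈ (extChartAt (𝓡 n) c).target)
    (hy' : (extChartAt (𝓡 n) c).symm y ∈ (extChartAt (𝓡 n) c').source) (u : 𝔼) :
    fderiv ℝ (transition c c') y u
      = chartDeriv c' ((extChartAt (𝓡 n) c).symm y) (chartSymmDeriv c y u) := by
  rw [← mfderiv_eq_fderiv, transition, mfderiv_comp (I' := 𝓡 n) y (mdifferentiableAt_chart hy')
    (mdifferentiableAt_extChartAt_symm hy)]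
  rfl

theorem contDiffAt_transition {c c' : M} {y : 𝔼} (hy : y ∈ (extChartAt (𝓡 n) c).target)
    (hy' : (extChartAt (𝓡 n) c).symm y ∈ (extChartAt (𝓡 n) c').source) :
    ContDiffAt ℝ ∞ (transition c c') y := by
  rw [← contMDiffAt_iff_contDiffAt]
  have h1 : ContMDiffAt 𝓘(ℝ, 𝔼) (𝓡 n) ∞ (extChartAt (𝓡 n) c).symm y :=
    (contMDiffOn_extChartAt_symm c).contMDiffAt ((isOpen_target c).mem_nhds hy)
  exact (contMDiffAt_extChartAt' (by simpa using hy')).comp y h1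

theorem isInvertible_of_inverse_apply {A B : 𝔼 →L[ℝ] 𝔼} (h : ∀ u, A (B u) = u)
    (h' : ∀ u, B (A u) = u) : A.IsInvertible :=
  ⟨ContinuousLinearEquiv.equivOfInverse A B h' h, by ext; rfl⟩

theorem isInvertible_fderiv_transition {c c' : M} {y : 𝔼} (hy : y ∈ (extChartAt (𝓡 n) c).target)
    (hy' : (extChartAt (𝓡 n) c).symm y ∈ (extChartAt (𝓡 n) c').source) :
    (fderiv ℝ (transition c c') y).IsInvertible := by
  have hx := (extChartAt (𝓡 n) c).map_target hy
  have e := (extChartAt (𝓡 n) c).right_inv hy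
  -- The inverse is the derivative of the reverse transition, written as a product of chart
  -- derivatives.
  refine isInvertible_of_inverse_apply
    (B := chartDeriv c ((extChartAt (𝓡 n) c).symm y) ∘L chartSymmDeriv c'
      (extChartAt (𝓡 n) c' ((extChartAt (𝓡 n) c).symm y))) (fun u => ?_) (fun u => ?_)
  · have h1 := chartSymmDeriv_chartDeriv hx (chartSymmDeriv c'
      (extChartAt (𝓡 n) c' ((extChartAt (𝓡 n) c).symm y)) u)
    rw [e] at h1
    rw [fderiv_transition hy hy', ContinuousLinearMap.comp_apply, h1]
    have h2 := chartDeriv_chartSymmDeriv ((extChartAt (𝓡 n) c').map_source hy') u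
    rwa [(extChartAt (𝓡 n) c').left_inv hy'] at h2
  · rw [fderiv_transition hy hy', ContinuousLinearMap.comp_apply, chartSymmDeriv_chartDeriv hy',
      chartDeriv_chartSymmDeriv hy]

theorem Metric.coord_transition (g : Metric n M) {c c' : M} {y : 𝔼}
    (hy : y ∈ (extChartAt (𝓡 n) c).target)
    (hy' : (extChartAt (𝓡 n) c).symm y ∈ (extChartAt (𝓡 n) c').source) (u v : 𝔼) :
    g.coord c y u v = g.coord c' (transition c c' y) (fderiv ℝ (transition c c') y u)
      (fderiv ℝ (transition c c') y v) := by
  rw [g.coord_eq_form, g.form_eq_coord hy', fderiv_transition hy hy', fderiv_transition hy hy']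
  rfl

/-- The coordinate expression of a smooth family of metrics is smooth. -/
theorem contDiffWithinAt_coord {g : ℝ → Metric n M} {J : Set ℝ}
    (hg : ContMDiffOn (𝓘(ℝ, ℝ).prod (𝓡 n))
      ((𝓡 n).prod 𝓘(ℝ, EuclideanSpace ℝ (Fin n) →L[ℝ] EuclideanSpace ℝ (Fin n) →L[ℝ] ℝ)) ∞
      (fun p : ℝ × M => (Bundle.TotalSpace.mk'
        (EuclideanSpace ℝ (Fin n) →L[ℝ] EuclideanSpace ℝ (Fin n) →L[ℝ] ℝ) p.2 ((g p.1).inner p.2) :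
        Bundle.TotalSpace (EuclideanSpace ℝ (Fin n) →L[ℝ] EuclideanSpace ℝ (Fin n) →L[ℝ] ℝ)
          (fun x : M => TangentSpace (𝓡 n) x →L[ℝ] TangentSpace (𝓡 n) x →L[ℝ] ℝ)))
      (J ×ˢ univ)) (c : M) {τ : ℝ} (hτ : τ ∈ J) {y : 𝔼} (hy : y ∈ (extChartAt (𝓡 n) c).target) :
    ContDiffWithinAt ℝ ∞ (fun p : ℝ × 𝔼 => (g p.1).coord c p.2) (J ×ˢ univ) (τ, y) := by
  have hopen : IsOpen ((univ : Set ℝ) ×ˢ (extChartAt (𝓡 n) c).target) :=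
    isOpen_univ.prod (isOpen_target c)
  suffices h : ContDiffOn ℝ ∞ (fun p : ℝ × 𝔼 => (g p.1).coord c p.2)
      (J ×ˢ (extChartAt (𝓡 n) c).target) by
    refine (h (τ, y) ⟨hτ, hy⟩).mono_of_mem_nhdsWithin ?_
    filter_upwards [self_mem_nhdsWithin,
      mem_nhdsWithin_of_mem_nhds (hopen.mem_nhds (x := (τ, y)) ⟨mem_univ _, hy⟩)] with q h1 h2
    exact ⟨h1.1, h2.2⟩
  have hsymm : ContMDiffOn 𝓘(ℝ, 𝔼) (𝓡 n) ∞ (extChartAt (𝓡 n) c).symm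
      (extChartAt (𝓡 n) c).target := contMDiffOn_extChartAt_symm c
  have hbase : ContMDiffOn 𝓘(ℝ, ℝ × 𝔼) (𝓘(ℝ, ℝ).prod (𝓡 n)) ∞
      (fun p : ℝ × 𝔼 => (p.1, (extChartAt (𝓡 n) c).symm p.2))
      (J ×ˢ (extChartAt (𝓡 n) c).target) := by
    refine ContMDiffOn.prodMk contDiff_fst.contMDiff.contMDiffOn ?_
    exact hsymm.comp contDiff_snd.contMDiff.contMDiffOn (fun p hp => hp.2)
  have hψ := hg.comp hbase (fun p hp => ⟨hp.1, mem_univ _⟩)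
  -- Constant fields on the chart image, pushed forward by the tangent map of the inverse chart, are
  -- smooth along the base map. Pairing two of them by the metric gives the coordinate entries,
  -- which suffice in finite dimension.
  have hvec : ∀ u : 𝔼, ContMDiffOn 𝓘(ℝ, ℝ × 𝔼) ((𝓡 n).prod 𝓘(ℝ, 𝔼)) ∞
      (fun p : ℝ × 𝔼 => (Bundle.TotalSpace.mk' 𝔼 ((extChartAt (𝓡 n) c).symm p.2)
        (chartSymmDeriv c p.2 u) : Bundle.TotalSpace 𝔼 (fun x : M => TangentSpace (𝓡 n) x)))
      (J ×ˢ (extChartAt (𝓡 n) c).target) := by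
    intro u
    have h1 := hsymm.contMDiffOn_tangentMapWithin (m := ∞) (by simp)
      (isOpen_target c).uniqueMDiffOn
    have h2 : ContMDiff 𝓘(ℝ, 𝔼) 𝓘(ℝ, 𝔼).tangent ∞
        (fun z : 𝔼 => (⟨z, u⟩ : TangentBundle 𝓘(ℝ, 𝔼) 𝔼)) := by
      intro z
      have := contMDiffAt_vectorSpace_iff_contDiffAt (𝕜 := ℝ) (n := ∞) (x := z)
        (V := fun z : 𝔼 => (u : TangentSpace 𝓘(ℝ, 𝔼) z))
      exact this.2 contDiffAt_const
    have h3 := (h1.comp h2.contMDiffOn (s := (extChartAt (𝓡 n) c).target) (fun z hz => hz)).comp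
      (s := J ×ˢ (extChartAt (𝓡 n) c).target) (I := 𝓘(ℝ, ℝ × 𝔼))
      (contDiff_snd (𝕜 := ℝ) (E := ℝ) (F := 𝔼)).contMDiff.contMDiffOn (fun p hp => hp.2)
    refine h3.congr fun p hp => ?_
    simp only [Function.comp_def, tangentMapWithin]
    rw [mfderivWithin_of_mem_nhds ((isOpen_target c).mem_nhds hp.2)]
    rfl
  rw [contDiffOn_clm_apply]
  intro u
  rw [contDiffOn_clm_apply]
  intro v
  rw [← contMDiffOn_iff_contDiffOn]
  intro p hp
  have := ContMDiffWithinAt.clm_bundle_apply₂ (F₁ := 𝔼) (F₂ := 𝔼) (F₃ := ℝ)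
    (E₁ := fun x : M => TangentSpace (𝓡 n) x) (E₂ := fun x : M => TangentSpace (𝓡 n) x)
    (E₃ := Bundle.Trivial M ℝ) (b := fun p : ℝ × 𝔼 => (extChartAt (𝓡 n) c).symm p.2)
    (hψ p hp) (hvec u p hp) (hvec v p hp)
  simp only [Bundle.contMDiffWithinAt_totalSpace] at this
  exact this.2

end Charts

/-! ### Independence of the chart, and velocities of curves. -/

section ChartInvariance

variable {n : ℕ} {M : Type*} [TopologicalSpace M] [ChartedSpace (EuclideanSpace ℝ (Fin n)) M]

local notation "𝔼" => EuclideanSpace ℝ (Fin n)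

theorem transition_self {c x : M} (hx : x ∈ (extChartAt (𝓡 n) c).source) :
    transition c x (extChartAt (𝓡 n) c x) = extChartAt (𝓡 n) x x := by
  simp only [transition, Function.comp_apply, (extChartAt (𝓡 n) c).left_inv hx]

/-- The derivative within `S` of the map `β`, in the direction `e`, as a coordinate vector. -/
noncomputable def mpd {X : Type*} [NormedAddCommGroup X] [NormedSpace ℝ X] (S : Set X) (e : X)
    (β : X → M) (q : X) : 𝔼 :=
  mfderivWithin 𝓘(ℝ, X) (𝓡 n) β S q e

/-- The chain rule that turns every velocity occurring in the statement into a directional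
derivative of one map `β`. -/
theorem velocity_comp {X : Type*} [NormedAddCommGroup X] [NormedSpace ℝ X] {S : Set X}
    {β : X → M} {q : X} (hβ : MDifferentiableWithinAt 𝓘(ℝ, X) (𝓡 n) β S q) {J : Set ℝ} {k : ℝ → X} {k' : X} {t : ℝ}
    (hk : HasDerivWithinAt k k' J t) (hkS : MapsTo k J S) (hkt : k t = q)
    (ht : t ∈ J) (hJ : UniqueDiffWithinAt ℝ J t) {c : ℝ → M} (hc : EqOn c (β ∘ k) J) :
    (velocity J c t : 𝔼) = mpd S k' β q := by
  subst hkt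
  have h1 : HasMFDerivWithinAt 𝓘(ℝ, ℝ) 𝓘(ℝ, X) k J t _ :=
    hk.hasFDerivWithinAt.hasMFDerivWithinAt
  have h2 := (hβ.hasMFDerivWithinAt.comp t h1 hkS).congr_of_eventuallyEq
    (eventually_of_mem self_mem_nhdsWithin hc) (hc ht)
  have h3 := h2.mfderivWithin hJ.uniqueMDiffWithinAt
  have h4 := congrArg (fun L : ℝ →L[ℝ] 𝔼 => L 1) h3
  refine Eq.trans h4 ?_
  change (mfderivWithin 𝓘(ℝ, X) (𝓡 n) β S (k t) : X →L[ℝ] 𝔼) ((1 : ℝ) • k') = _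
  rw [one_smul]
  rfl

theorem velocity_univ {J : Set ℝ} {c : ℝ → M} {t : ℝ} (hJ : J ∈ 𝓝 t) :
    (velocity univ c t : 𝔼) = (velocity J c t : 𝔼) := by
  rw [velocity, velocity, mfderivWithin_of_mem_nhds hJ, mfderivWithin_univ]

variable [IsManifold (𝓡 n) ∞ M]

theorem Metric.contDiffAt_coord (g : Metric n M) (c : M) {y : 𝔼}
    (hy : y ∈ (extChartAt (𝓡 n) c).target) : ContDiffAt ℝ ∞ (g.coord c) y := by
  refine contDiffAt_of_joint (H := fun _ => g.coord c) (J := univ) (τ := 0) (mem_univ _) ?_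
  refine contDiffWithinAt_coord (g := fun _ => g) (J := univ) ?_ c (mem_univ _) hy
  exact (g.contMDiff.comp contMDiff_snd).contMDiffOn

theorem Metric.coord_symm (g : Metric n M) (c : M) (y u v : 𝔼) :
    g.coord c y u v = g.coord c y v u := by
  rw [g.coord_apply, g.coord_apply, g.symm]

theorem Metric.coord_pos (g : Metric n M) (c : M) {y : 𝔼}
    (hy : y ∈ (extChartAt (𝓡 n) c).target) (u : 𝔼) (hu : u ≠ 0) : 0 < g.coord c y u u := by
  rw [g.coord_apply]
  refine g.pos _ _ fun h => hu ?_
  have h0 : chartSymmDeriv c y u = 0 := h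
  rw [← chartDeriv_chartSymmDeriv hy u, h0, map_zero]

theorem Metric.isMetricAt_coord (g : Metric n M) (c : M) {y : 𝔼}
    (hy : y ∈ (extChartAt (𝓡 n) c).target) : IsMetricAt (g.coord c) y := by
  have h := (isOpen_target c).mem_nhds hy
  exact ⟨mem_of_superset h fun z hz => g.contDiffAt_coord c hz,
    Eventually.of_forall fun z => g.coord_symm c z,
    mem_of_superset h fun z hz => g.coord_pos c hz⟩

theorem Metric.isPullbackAt (g : Metric n M) {c c' : M} {y : 𝔼}
    (hy : y ∈ (extChartAt (𝓡 n) c).target)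
    (hy' : (extChartAt (𝓡 n) c).symm y ∈ (extChartAt (𝓡 n) c').source) :
    IsPullbackAt (g.coord c') (g.coord c) (transition c c') y := by
  have hev := eventually_mem_source hy hy'
  exact ⟨g.isMetricAt_coord c' ((extChartAt (𝓡 n) c').map_source hy'), g.isMetricAt_coord c hy,
    hev.mono fun z hz => contDiffAt_transition hz.1 hz.2,
    hev.mono fun z hz => isInvertible_fderiv_transition hz.1 hz.2,
    hev.mono fun z hz => g.coord_transition hz.1 hz.2⟩

theorem Metric.isPullbackAt_self (g : Metric n M) {c x : M}
    (hx : x ∈ (extChartAt (𝓡 n) c).source) :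
    IsPullbackAt (g.coord x) (g.coord c) (transition c x) (extChartAt (𝓡 n) c x) := by
  refine g.isPullbackAt ((extChartAt (𝓡 n) c).map_source hx) ?_
  rw [(extChartAt (𝓡 n) c).left_inv hx]
  exact mem_extChartAt_source x

/-- The transition leads to the preferred chart at `x`, whose derivative at `x` is the identity. -/
theorem fderiv_transition_chartDeriv {c x : M} (hx : x ∈ (extChartAt (𝓡 n) c).source) (u : 𝔼) :
    fderiv ℝ (transition c x) (extChartAt (𝓡 n) c x) (chartDeriv c x u) = u := by
  rw [fderiv_transition ((extChartAt (𝓡 n) c).map_source hx) (by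
    rw [(extChartAt (𝓡 n) c).left_inv hx]; exact mem_extChartAt_source x),
    chartSymmDeriv_chartDeriv hx, (extChartAt (𝓡 n) c).left_inv hx, chartDeriv_self]
  rfl

/-- The Ricci tensor may be computed in any chart. -/
theorem Metric.ricciAt_eq (g : Metric n M) {c x : M} (hx : x ∈ (extChartAt (𝓡 n) c).source)
    (u v : 𝔼) : g.ricciAt x u v
      = ricci (g.coord c) (extChartAt (𝓡 n) c x) (chartDeriv c x u) (chartDeriv c x v) := by
  rw [(g.isPullbackAt_self hx).ricci_eq, transition_self hx, fderiv_transition_chartDeriv hx,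
    fderiv_transition_chartDeriv hx]
  rfl

/-- The scalar curvature may be computed in any chart. -/
theorem Metric.scalarAt_eq (g : Metric n M) {c x : M} (hx : x ∈ (extChartAt (𝓡 n) c).source) :
    g.scalarAt x = scalar (g.coord c) (extChartAt (𝓡 n) c x) := by
  rw [(g.isPullbackAt_self hx).scalar_eq, transition_self hx]
  rfl

/-- The gradient and the Hessian of `scalarAt` differentiate a function whose value at each point is
computed in that point's own chart; near `c` a single chart may be used instead. -/
theorem Metric.scalarAt_comp_eventuallyEq (g : Metric n M) (c : M) :
    g.scalarAt ∘ (extChartAt (𝓡 n) c).symm =ᶠ[𝓝 (extChartAt (𝓡 n) c c)] scalar (g.coord c) := by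
  filter_upwards [(isOpen_target c).mem_nhds (mem_extChartAt_target c)] with y hy
  rw [Function.comp_apply, g.scalarAt_eq ((extChartAt (𝓡 n) c).map_target hy),
    (extChartAt (𝓡 n) c).right_inv hy]

theorem isRegularDomain_Icc_prod_univ {T : ℝ} (hT : 0 < T) :
    IsRegularDomain (Icc 0 T ×ˢ (univ : Set 𝔼)) := by
  refine ((convex_Icc 0 T).prod convex_univ).isRegularDomain ?_
  rw [interior_prod_eq, interior_Icc, interior_univ]
  exact (nonempty_Ioo.2 hT).prod univ_nonempty

/-- The coordinate expressions of a family of metrics in the chart around `c`. -/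
noncomputable def coordFlow (g : ℝ → Metric n M) (c : M) (r : ℝ) : 𝔼 → 𝔼 →L[ℝ] 𝔼 →L[ℝ] ℝ := (g r).coord c

theorem IsBackwardRicciFlow.isFlowOn {g : ℝ → Metric n M} {T : ℝ} (hg : IsBackwardRicciFlow g T)
    (hT : 0 < T) (c : M) :
    IsFlowOn (coordFlow g c) (Icc 0 T) (extChartAt (𝓡 n) c).target where
  isOpen := isOpen_target c
  regular := isRegularDomain_Icc_prod_univ hT
  uniqueDiffOn := uniqueDiffOn_Icc hT
  smooth τ hτ y hy := contDiffWithinAt_coord hg.smooth c hτ hy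
  symm τ _ y _ := (g τ).coord_symm c y
  pos τ _ y hy := (g τ).coord_pos c hy
  evolution τ hτ y hy := by
    have h1 : HasFDerivWithinAt (fun r : ℝ => ((r, y) : ℝ × 𝔼)) (ContinuousLinearMap.inl ℝ ℝ 𝔼)
      (Icc 0 T) τ := (hasFDerivAt_prodMk_left τ y).hasFDerivWithinAt
    have h2 := (HasFDerivWithinAt.comp (t := Icc 0 T ×ˢ (univ : Set 𝔼))
      (g := fun p : ℝ × 𝔼 => (g p.1).coord c p.2) τ
      (contDiffWithinAt_coord hg.smooth c hτ hy).hasFDerivWithinAt_infty h1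
      (fun r hr => ⟨hr, mem_univ _⟩)).hasDerivWithinAt
    refine h2.congr_deriv ?_
    ext u v
    have h3 := (h2.clm_apply (hasDerivWithinAt_const τ _ u)).clm_apply
      (hasDerivWithinAt_const τ _ v)
    -- The evolution equation is tested on the tangent vectors with coordinates `u` and `v` in the
    -- chart around `c`; `Metric.ricciAt_eq` then moves the Ricci tensor into that chart.
    have h4 := hg.evolution τ hτ ((extChartAt (𝓡 n) c).symm y) (chartSymmDeriv c y u)
      (chartSymmDeriv c y v)
    have h5 := (uniqueDiffOn_Icc hT τ hτ).eq_deriv _ h3 h4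
    rw [(g τ).ricciAt_eq ((extChartAt (𝓡 n) c).map_target hy), chartDeriv_chartSymmDeriv hy,
      chartDeriv_chartSymmDeriv hy, (extChartAt (𝓡 n) c).right_inv hy] at h5
    simpa [coordFlow] using h5

section Mpd

variable {X : Type*} [NormedAddCommGroup X] [NormedSpace ℝ X] {S : Set X} {β : X → M} {q : X}

theorem chartDeriv_mpd {c : M} (hS : IsRegularDomain S) (hq : q ∈ S)
    (hβ : MDifferentiableWithinAt 𝓘(ℝ, X) (𝓡 n) β S q)
    (hc : β q ∈ (extChartAt (𝓡 n) c).source) (e : X) :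
    chartDeriv c (β q) (mpd S e β q) = pd S e (extChartAt (𝓡 n) c ∘ β) q := by
  rw [pd, ← mfderivWithin_eq_fderivWithin]
  have hu : UniqueMDiffWithinAt 𝓘(ℝ, X) S q := (hS.uniqueDiffOn q hq).uniqueMDiffWithinAt
  have := mfderiv_comp_mfderivWithin q (mdifferentiableAt_chart hc) hβ hu
  rw [this]
  rfl

end Mpd

theorem covDeriv_eq (g : Metric n M) {J : Set ℝ} {c : ℝ → M}
    {V : ∀ t, TangentSpace (𝓡 n) (c t)} {t : ℝ} {f : ℝ → 𝔼} {f' : 𝔼}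
    (hf : HasDerivWithinAt f f' J t) (ht : t ∈ J) (hJ : UniqueDiffWithinAt ℝ J t)
    (hfV : ∀ᶠ r in 𝓝[J] t, chartDeriv (c t) (c r) (V r) = f r) :
    (g.covDeriv J c V t : 𝔼) = f' + christoffel (g.coord (c t)) (extChartAt (𝓡 n) (c t) (c t))
      (velocity J c t) (V t) := by
  have h : HasDerivWithinAt (fun r => chartDeriv (c t) (c r) (V r)) f' J t :=
    hf.congr_of_eventuallyEq hfV (hfV.self_of_nhdsWithin ht)
  change derivWithin (fun r => chartDeriv (c t) (c r) (V r)) J t + _ = _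
  rw [h.derivWithin hJ]

end ChartInvariance

/-! ### Differentiation under the integral and the substitution `τ = σ²`. -/

section Analysis

open MeasureTheory

variable {X F : Type*} [NormedAddCommGroup X] [NormedSpace ℝ X]
  [NormedAddCommGroup F] [NormedSpace ℝ F]

theorem hasDerivWithinAt_comp_curve {S : Set X} {q : X} {f : X → F}
    (hf : ContDiffWithinAt ℝ ∞ f S q) {J : Set ℝ} {k : ℝ → X} {k' : X} {t : ℝ}
    (hk : HasDerivWithinAt k k' J t) (hkS : MapsTo k J S) (hkt : k t = q) :
    HasDerivWithinAt (fun r => f (k r)) (pd S k' f q) J t := by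
  subst hkt
  exact hf.hasFDerivWithinAt_infty.comp_hasDerivWithinAt t hk hkS

variable {ε a : ℝ} {f : ℝ × ℝ → F}

theorem isRegularDomain_strip (hε : 0 < ε) (ha : 0 < a) :
    IsRegularDomain (Ioo (-ε) ε ×ˢ Icc 0 a) := by
  refine ((convex_Ioo _ _).prod (convex_Icc 0 a)).isRegularDomain ?_
  rw [interior_prod_eq, interior_Icc, interior_Ioo]
  exact (nonempty_Ioo.2 (by linarith)).prod (nonempty_Ioo.2 ha)

theorem hasDerivAt_fst_of_strip {s σ : ℝ} (hs : s ∈ Ioo (-ε) ε) (hσ : σ ∈ Icc 0 a)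
    (hf : ContDiffWithinAt ℝ ∞ f (Ioo (-ε) ε ×ˢ Icc 0 a) (s, σ)) :
    HasDerivAt (fun r => f (r, σ)) (pd (Ioo (-ε) ε ×ˢ Icc 0 a) e₁ f (s, σ)) s := by
  have hk : HasDerivWithinAt (fun r : ℝ => (r, σ)) e₁ (Ioo (-ε) ε) s :=
    ((hasDerivAt_id s).prodMk (hasDerivAt_const s σ)).hasDerivWithinAt
  exact (hasDerivWithinAt_comp_curve hf hk (fun r hr => ⟨hr, hσ⟩) rfl).hasDerivAt
    (isOpen_Ioo.mem_nhds hs)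

theorem hasDerivWithinAt_snd_of_strip {s σ : ℝ} (hs : s ∈ Ioo (-ε) ε)
    (hf : ContDiffWithinAt ℝ ∞ f (Ioo (-ε) ε ×ˢ Icc 0 a) (s, σ)) :
    HasDerivWithinAt (fun r => f (s, r)) (pd (Ioo (-ε) ε ×ˢ Icc 0 a) e₂ f (s, σ)) (Icc 0 a) σ := by
  have hk : HasDerivWithinAt (fun r : ℝ => (s, r)) e₂ (Icc 0 a) σ :=
    ((hasDerivAt_const σ s).prodMk (hasDerivAt_id σ)).hasDerivWithinAt
  exact hasDerivWithinAt_comp_curve hf hk (fun r hr => ⟨hs, hr⟩) rfl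

theorem continuousOn_slice {Y : Type*} [TopologicalSpace Y] {f : ℝ × ℝ → Y} {ε a s : ℝ}
    (hs : s ∈ Ioo (-ε) ε) (hf : ContinuousOn f (Ioo (-ε) ε ×ˢ Icc 0 a)) :
    ContinuousOn (fun σ => f (s, σ)) (Icc 0 a) :=
  hf.comp (by fun_prop) (fun _ hσ => ⟨hs, hσ⟩)

/-- Differentiation under the integral sign over the fibres of a strip. -/
theorem hasDerivAt_integral_strip [CompleteSpace F] (hε : 0 < ε) (ha : 0 < a)
    (hf : ∀ q ∈ Ioo (-ε) ε ×ˢ Icc 0 a, ContDiffWithinAt ℝ ∞ f (Ioo (-ε) ε ×ˢ Icc 0 a) q)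
    {s : ℝ} (hs : s ∈ Ioo (-ε) ε) :
    HasDerivAt (fun r => ∫ σ in 0..a, f (r, σ))
      (∫ σ in 0..a, pd (Ioo (-ε) ε ×ˢ Icc 0 a) e₁ f (s, σ)) s := by
  have hS := isRegularDomain_strip hε ha
  have hfc : ContinuousOn f (Ioo (-ε) ε ×ˢ Icc 0 a) := fun q hq => (hf q hq).continuousWithinAt
  have hdc : ContinuousOn (pd (Ioo (-ε) ε ×ˢ Icc 0 a) e₁ f) (Ioo (-ε) ε ×ˢ Icc 0 a) :=
    fun q hq => ((hf q hq).pd hS hq e₁).continuousWithinAt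
  -- A compact neighbourhood of the fibre over `s` bounds the continuous `s`-derivative by a
  -- constant, which serves as dominating function.
  obtain ⟨δ, hδ, hδs⟩ := Metric.nhds_basis_closedBall.mem_iff.1 (isOpen_Ioo.mem_nhds hs)
  have hK : IsCompact (Metric.closedBall s δ ×ˢ Icc 0 a) :=
    (isCompact_closedBall s δ).prod isCompact_Icc
  obtain ⟨C, hC⟩ := hK.exists_bound_of_continuousOn
    (hdc.mono (prod_mono hδs Subset.rfl))
  have hsub : uIoc 0 a ⊆ Icc 0 a := by
    rw [uIoc_of_le ha.le]; exact Ioc_subset_Icc_self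
  have hmeas : ∀ {h : ℝ → F}, ContinuousOn h (Icc 0 a) →
      AEStronglyMeasurable h (volume.restrict (uIoc 0 a)) := fun hh =>
    (hh.mono hsub).aestronglyMeasurable measurableSet_uIoc
  refine (intervalIntegral.hasDerivAt_integral_of_dominated_loc_of_deriv_le
    (F := fun r σ => f (r, σ)) (F' := fun r σ => pd (Ioo (-ε) ε ×ˢ Icc 0 a) e₁ f (r, σ))
    (bound := fun _ => C) (Metric.closedBall_mem_nhds s hδ) ?_ ?_ ?_ ?_ ?_ ?_).2
  · filter_upwards [isOpen_Ioo.mem_nhds hs] with r hr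
    exact hmeas (continuousOn_slice hr hfc)
  · exact ContinuousOn.intervalIntegrable (by
      rw [uIcc_of_le ha.le]; exact continuousOn_slice hs hfc)
  · exact hmeas (continuousOn_slice hs hdc)
  · exact Eventually.of_forall fun σ hσ r hr => hC (r, σ) ⟨hr, hsub hσ⟩
  · exact intervalIntegrable_const
  · exact Eventually.of_forall fun σ hσ r hr =>
      hasDerivAt_fst_of_strip (hδs hr) (hsub hσ) (hf (r, σ) ⟨hδs hr, hsub hσ⟩)

/-- The substitution `τ = σ²`. -/
theorem integral_comp_sq {b : ℝ} (hb : 0 < b) {f h : ℝ → ℝ} (hh : ContinuousOn h (Icc 0 √b))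
    (hfh : ∀ σ ∈ Ioo 0 √b, 2 * σ * f (σ ^ 2) = h σ) :
    IntervalIntegrable f volume 0 b ∧ ∫ τ in 0..b, f τ = ∫ σ in 0..√b, h σ := by
  have ha : 0 < √b := Real.sqrt_pos.2 hb
  have himg : (fun σ : ℝ => σ ^ 2) '' Ioo 0 √b = Ioo 0 b := by
    ext τ
    constructor
    · rintro ⟨σ, hσ, rfl⟩
      refine ⟨by have := hσ.1; positivity, ?_⟩
      exact (Real.lt_sqrt hσ.1.le).1 hσ.2
    · intro hτ
      exact ⟨√τ, ⟨Real.sqrt_pos.2 hτ.1, Real.sqrt_lt_sqrt hτ.1.le hτ.2⟩, Real.sq_sqrt hτ.1.le⟩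
  have hd : ∀ σ ∈ Ioo 0 √b, HasDerivWithinAt (fun σ : ℝ => σ ^ 2) (2 * σ) (Ioo 0 √b) σ :=
    fun σ _ => by simpa using (hasDerivAt_pow 2 σ).hasDerivWithinAt
  have hinj : InjOn (fun σ : ℝ => σ ^ 2) (Ioo 0 √b) := fun x hx y hy hxy =>
    (sq_eq_sq₀ hx.1.le hy.1.le).1 hxy
  have hcongr : EqOn (fun σ => |2 * σ| • f (σ ^ 2)) h (Ioo 0 √b) := fun σ hσ => by
    have : 0 < 2 * σ := by linarith [hσ.1]
    simp only [abs_of_pos this, smul_eq_mul]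
    exact hfh σ hσ
  -- Nothing is asked of `f` at the endpoints, a null set; its integrability is inherited from `h`,
  -- which is continuous on the closed interval.
  have hhi : IntegrableOn h (Ioo 0 √b) :=
    (hh.integrableOn_Icc).mono_set Ioo_subset_Icc_self
  constructor
  · rw [intervalIntegrable_iff_integrableOn_Ioo_of_le hb.le, ← himg,
      integrableOn_image_iff_integrableOn_abs_deriv_smul measurableSet_Ioo hd hinj]
    exact hhi.congr_fun hcongr.symm measurableSet_Ioo
  · rw [intervalIntegral.integral_of_le hb.le, intervalIntegral.integral_of_le ha.le,
      integral_Ioc_eq_integral_Ioo, integral_Ioc_eq_integral_Ioo, ← himg,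
      integral_image_eq_integral_abs_deriv_smul measurableSet_Ioo hd hinj]
    exact setIntegral_congr_fun measurableSet_Ioo hcongr

end Analysis

/-! ### Energy and boundary densities of a variation in the manifold. -/

section Variation

/-- The coordinate expression of a variation in the chart around `c`. -/
noncomputable def coordMap (n : ℕ) {M : Type*} [TopologicalSpace M] [ChartedSpace (EuclideanSpace ℝ (Fin n)) M]
    (c : M) (β : ℝ × ℝ → M) : ℝ × ℝ → EuclideanSpace ℝ (Fin n) := extChartAt (𝓡 n) c ∘ β

/-- The part of the domain of a variation which is mapped to the chart around `c`. -/
def dom (n : ℕ) {M : Type*} [TopologicalSpace M] [ChartedSpace (EuclideanSpace ℝ (Fin n)) M]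
    (S : Set (ℝ × ℝ)) (β : ℝ × ℝ → M) (c : M) : Set (ℝ × ℝ) :=
  S ∩ β ⁻¹' (extChartAt (𝓡 n) c).source

theorem mem_dom {n : ℕ} {M : Type*} [TopologicalSpace M]
    [ChartedSpace (EuclideanSpace ℝ (Fin n)) M] {S : Set (ℝ × ℝ)} {β : ℝ × ℝ → M} {p : ℝ × ℝ}
    (hp : p ∈ S) : p ∈ dom n S β (β p) := ⟨hp, mem_extChartAt_source (β p)⟩

variable {n : ℕ} {M : Type*} [TopologicalSpace M] [ChartedSpace (EuclideanSpace ℝ (Fin n)) M]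

local notation "𝔼" => EuclideanSpace ℝ (Fin n)

/-- A smooth variation `β` on the domain `S`, whose second parameter is the square root of a time
in `[0, T]`. -/
structure IsVariation (n : ℕ) {M : Type*} [TopologicalSpace M]
    [ChartedSpace (EuclideanSpace ℝ (Fin n)) M] (T : ℝ) (S : Set (ℝ × ℝ)) (β : ℝ × ℝ → M) :
    Prop where
  regular : IsRegularDomain S
  time : ∀ q ∈ S, q.2 ^ 2 ∈ Icc 0 T
  smooth : ContMDiffOn 𝓘(ℝ, ℝ × ℝ) (𝓡 n) ∞ β S

theorem IsVariation.mdifferentiableWithinAt {T : ℝ} {S : Set (ℝ × ℝ)} {β : ℝ × ℝ → M}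
    {p : ℝ × ℝ} (h : IsVariation n T S β) (hp : p ∈ S) :
    MDifferentiableWithinAt 𝓘(ℝ, ℝ × ℝ) (𝓡 n) β S p :=
  (h.smooth p hp).mdifferentiableWithinAt (by simp)

variable [IsManifold (𝓡 n) ∞ M]

/-- The integrand of the `ℒ`-length with respect to the square root of time. -/
noncomputable def energyDensity (g : ℝ → Metric n M) (S : Set (ℝ × ℝ)) (β : ℝ × ℝ → M)
    (q : ℝ × ℝ) : ℝ :=
  2 * q.2 ^ 2 * (g (q.2 ^ 2)).scalarAt (β q)
    + 1 / 2 * (g (q.2 ^ 2)).form (β q) (mpd S e₂ β q) (mpd S e₂ β q)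

/-- The function `⟨∇_Y Y, V⟩`, where `V` is the derivative with respect to the square root of time,
in a form that does not mention the connection. -/
noncomputable def boundaryDensity (g : ℝ → Metric n M) (S : Set (ℝ × ℝ)) (β : ℝ × ℝ → M)
    (q : ℝ × ℝ) : ℝ :=
  pd S e₁ (fun q => (g (q.2 ^ 2)).form (β q) (mpd S e₁ β q) (mpd S e₂ β q)) q
    - 1 / 2 * pd S e₂ (fun q => (g (q.2 ^ 2)).form (β q) (mpd S e₁ β q) (mpd S e₁ β q)) q
    + 2 * q.2 * (g (q.2 ^ 2)).ricciAt (β q) (mpd S e₁ β q) (mpd S e₁ β q)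

namespace IsVariation

variable {g : ℝ → Metric n M} {T : ℝ} {S : Set (ℝ × ℝ)} {β : ℝ × ℝ → M} {p : ℝ × ℝ}

theorem isVariationOn (h : IsVariation n T S β) (c : M) :
    IsVariationOn (Icc 0 T) (extChartAt (𝓡 n) c).target S (dom n S β c)
      (coordMap n c β) where
  regular := h.regular
  subset := inter_subset_left
  mem_nhdsWithin q hq := by
    have := (h.smooth q hq.1).continuousWithinAt.preimage_mem_nhdsWithin
      ((isOpen_extChartAt_source (I := 𝓡 n) c).mem_nhds hq.2)
    exact inter_mem self_mem_nhdsWithin this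
  time := h.time
  maps q hq := (extChartAt (𝓡 n) c).map_source hq.2
  smooth q hq := by
    rw [← contMDiffWithinAt_iff_contDiffWithinAt]
    exact (contMDiffAt_extChartAt' (by simpa using hq.2)).comp_contMDiffWithinAt q (h.smooth q hq.1)

theorem chartDeriv_mpd (h : IsVariation n T S β) {c : M} (hp : p ∈ dom n S β c) (e : ℝ × ℝ) :
    chartDeriv c (β p) (mpd S e β p) = pd S e (coordMap n c β) p :=
  RicciL.chartDeriv_mpd h.regular hp.1 (h.mdifferentiableWithinAt hp.1) hp.2 e

theorem form_eq (h : IsVariation n T S β) {c : M} (hp : p ∈ dom n S β c) (e e' : ℝ × ℝ) :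
    (g (p.2 ^ 2)).form (β p) (mpd S e β p) (mpd S e' β p)
      = coordFlow g c (p.2 ^ 2) (coordMap n c β p) (pd S e (coordMap n c β) p)
        (pd S e' (coordMap n c β) p) := by
  rw [(g (p.2 ^ 2)).form_eq_coord hp.2, h.chartDeriv_mpd hp, h.chartDeriv_mpd hp]
  rfl

theorem ricciAt_eq (h : IsVariation n T S β) {c : M} (hp : p ∈ dom n S β c) (e e' : ℝ × ℝ) :
    (g (p.2 ^ 2)).ricciAt (β p) (mpd S e β p) (mpd S e' β p)
      = ricci (coordFlow g c (p.2 ^ 2)) (coordMap n c β p)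
        (pd S e (coordMap n c β) p) (pd S e' (coordMap n c β) p) := by
  rw [(g (p.2 ^ 2)).ricciAt_eq hp.2, h.chartDeriv_mpd hp, h.chartDeriv_mpd hp]
  rfl

theorem form_eventuallyEq (h : IsVariation n T S β) {c : M} (hp : p ∈ dom n S β c) (e e' : ℝ × ℝ) :
    (fun q => (g (q.2 ^ 2)).form (β q) (mpd S e β q) (mpd S e' β q)) =ᶠ[𝓝[S] p]
      fun q => coordFlow g c (q.2 ^ 2) (coordMap n c β q)
        (pd S e (coordMap n c β) q) (pd S e' (coordMap n c β) q) := by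
  filter_upwards [(h.isVariationOn c).mem_nhdsWithin p hp] with q hq
  exact h.form_eq hq e e'

theorem energyDensity_eq (h : IsVariation n T S β) {c : M} (hp : p ∈ dom n S β c) :
    energyDensity g S β p = 2 * p.2 ^ 2 * scalar (coordFlow g c (p.2 ^ 2))
        (coordMap n c β p)
      + 1 / 2 * coordFlow g c (p.2 ^ 2) (coordMap n c β p)
        (pd S e₂ (coordMap n c β) p) (pd S e₂ (coordMap n c β) p) := by
  rw [energyDensity, (g (p.2 ^ 2)).scalarAt_eq hp.2, h.form_eq hp]
  rfl

theorem energyDensity_eventuallyEq (h : IsVariation n T S β) {c : M} (hp : p ∈ dom n S β c) :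
    energyDensity g S β =ᶠ[𝓝[S] p] fun q => 2 * q.2 ^ 2 * scalar (coordFlow g c (q.2 ^ 2))
        (coordMap n c β q)
      + 1 / 2 * coordFlow g c (q.2 ^ 2) (coordMap n c β q)
        (pd S e₂ (coordMap n c β) q) (pd S e₂ (coordMap n c β) q) := by
  filter_upwards [(h.isVariationOn c).mem_nhdsWithin p hp] with q hq
  exact h.energyDensity_eq hq

/-- Smoothness is local, so the chart around `β p` suffices. It includes the edge `σ = 0`, where the
integrand in the original time need not be smooth. -/
theorem smooth_energyDensity (h : IsVariation n T S β) (hg : IsBackwardRicciFlow g T) (hT : 0 < T)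
    (hp : p ∈ S) :
    ContDiffWithinAt ℝ ∞ (energyDensity g S β) S p := by
  have hd : p ∈ dom n S β (β p) := mem_dom hp
  have hv := h.isVariationOn (β p)
  have hG := hg.isFlowOn hT (β p)
  refine ContDiffWithinAt.congr_of_eventuallyEq ?_ (h.energyDensity_eventuallyEq hd)
    (h.energyDensity_eq hd)
  exact ((contDiffWithinAt_const.mul (contDiffWithinAt_snd.pow 2)).mul
    (hv.smooth_scalar hG hd)).add (contDiffWithinAt_const.mul
      (hv.smooth_inner hG hd (hv.smooth_pd hd e₂) (hv.smooth_pd hd e₂)))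

/-- The definition uses only inner products and Ric, already known to be chart independent. Hence
`⟨∇_Y Y, V⟩` may be computed in any chart, with no separate invariance proof for `∇_Y Y`. -/
theorem boundaryDensity_eq (h : IsVariation n T S β) (hg : IsBackwardRicciFlow g T) (hT : 0 < T) {c : M}
    (hp : p ∈ dom n S β c) :
    boundaryDensity g S β p = coordFlow g c (p.2 ^ 2) (coordMap n c β p)
      (covD (coordFlow g c) S (coordMap n c β) e₁
        (pd S e₁ (coordMap n c β)) p) (pd S e₂ (coordMap n c β) p) := by
  have hv := h.isVariationOn c
  have hG := hg.isFlowOn hT c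
  rw [← hv.inner_covD hG hp, boundaryDensity, pd_congr hp.1 (h.form_eventuallyEq hp e₁ e₂),
    pd_congr hp.1 (h.form_eventuallyEq hp e₁ e₁), h.ricciAt_eq hp]

theorem boundaryDensity_eventuallyEq (h : IsVariation n T S β) (hg : IsBackwardRicciFlow g T) (hT : 0 < T) {c : M}
    (hp : p ∈ dom n S β c) :
    boundaryDensity g S β =ᶠ[𝓝[S] p] fun q =>
      coordFlow g c (q.2 ^ 2) (coordMap n c β q)
      (covD (coordFlow g c) S (coordMap n c β) e₁
        (pd S e₁ (coordMap n c β)) q) (pd S e₂ (coordMap n c β) q) := by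
  filter_upwards [(h.isVariationOn c).mem_nhdsWithin p hp] with q hq
  exact h.boundaryDensity_eq hg hT hq

theorem smooth_boundaryDensity (h : IsVariation n T S β) (hg : IsBackwardRicciFlow g T) (hT : 0 < T)
    (hp : p ∈ S) :
    ContDiffWithinAt ℝ ∞ (boundaryDensity g S β) S p := by
  have hd : p ∈ dom n S β (β p) := mem_dom hp
  have hv := h.isVariationOn (β p)
  have hG := hg.isFlowOn hT (β p)
  refine ContDiffWithinAt.congr_of_eventuallyEq ?_ (h.boundaryDensity_eventuallyEq hg hT hd)
    (h.boundaryDensity_eq hg hT hd)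
  exact hv.smooth_inner hG hd (hv.smooth_covD hG hd (hv.smooth_pd hd e₁) e₁) (hv.smooth_pd hd e₂)

/-- The second variation of the energy density, along a curve satisfying the geodesic equation. -/
theorem pd_pd_energyDensity (h : IsVariation n T S β) (hg : IsBackwardRicciFlow g T) (hT : 0 < T)
    {c : M} (hp : p ∈ dom n S β c)
    (hgeo : covD (coordFlow g c) S (coordMap n c β) e₂
        (pd S e₂ (coordMap n c β)) p = (2 * p.2 ^ 2) •
      gradient (coordFlow g c (p.2 ^ 2)) (scalar (coordFlow g c (p.2 ^ 2)))
        (coordMap n c β p)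
      - (4 * p.2) • ricciSharp (coordFlow g c (p.2 ^ 2)) (coordMap n c β p)
        (pd S e₂ (coordMap n c β) p)) :
    pd S e₁ (pd S e₁ (energyDensity g S β)) p = pd S e₂ (boundaryDensity g S β) p
      + 2 * p.2 ^ 2 * hessian (coordFlow g c (p.2 ^ 2)) (scalar (coordFlow g c (p.2 ^ 2)))
        (coordMap n c β p) (pd S e₁ (coordMap n c β) p)
        (pd S e₁ (coordMap n c β) p)
      + coordFlow g c (p.2 ^ 2) (coordMap n c β p)
        (covD (coordFlow g c) S (coordMap n c β) e₂
          (pd S e₁ (coordMap n c β)) p)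
        (covD (coordFlow g c) S (coordMap n c β) e₂
          (pd S e₁ (coordMap n c β)) p)
      + coordFlow g c (p.2 ^ 2) (coordMap n c β p)
        (riemann (coordFlow g c (p.2 ^ 2)) (coordMap n c β p)
          (pd S e₁ (coordMap n c β) p) (pd S e₂ (coordMap n c β) p)
          (pd S e₁ (coordMap n c β) p)) (pd S e₂ (coordMap n c β) p)
      + 2 * p.2 * nablaRicci (coordFlow g c (p.2 ^ 2)) (coordMap n c β p)
        (pd S e₂ (coordMap n c β) p) (pd S e₁ (coordMap n c β) p)
        (pd S e₁ (coordMap n c β) p)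
      - 4 * p.2 * nablaRicci (coordFlow g c (p.2 ^ 2)) (coordMap n c β p)
        (pd S e₁ (coordMap n c β) p) (pd S e₁ (coordMap n c β) p)
        (pd S e₂ (coordMap n c β) p) := by
  have hv := h.isVariationOn c
  have hG := hg.isFlowOn hT c
  have hev : pd S e₁ (energyDensity g S β) =ᶠ[𝓝[S] p] pd S e₁ (fun q => 2 * q.2 ^ 2 *
        scalar (coordFlow g c (q.2 ^ 2)) (coordMap n c β q)
      + 1 / 2 * coordFlow g c (q.2 ^ 2) (coordMap n c β q)
        (pd S e₂ (coordMap n c β) q) (pd S e₂ (coordMap n c β) q)) := by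
    filter_upwards [hv.mem_nhdsWithin p hp] with q hq
    exact pd_congr hq.1 (h.energyDensity_eventuallyEq hq)
  rw [pd_congr hp.1 hev, pd_congr hp.1 (h.boundaryDensity_eventuallyEq hg hT hp)]
  exact hv.pd_pd_energy hG hp hgeo

end IsVariation

end Variation

/-! ### Translation between time `τ` and its square root `σ`. -/

section SquareRootTime

/-- The variation `γ`, parametrized by the square root of time. -/
def sqMap {M : Type*} (γ : ℝ → ℝ → M) (q : ℝ × ℝ) : M := γ q.1 (q.2 ^ 2)

/-- The domain of a variation parametrized by the square root of time. -/
def strip (ε b : ℝ) : Set (ℝ × ℝ) := Ioo (-ε) ε ×ˢ Icc 0 √b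

theorem sqMap_sqrt {M : Type*} (γ : ℝ → ℝ → M) (s : ℝ) {r : ℝ} (hr : 0 ≤ r) : sqMap γ (s, √r) = γ s r := by
  simp [sqMap, Real.sq_sqrt hr]

theorem mapsTo_sqrt {ε b s : ℝ} (hs : s ∈ Ioo (-ε) ε) :
    MapsTo (fun r : ℝ => (s, √r)) (Icc 0 b) (strip ε b) :=
  fun _ hr => ⟨hs, Real.sqrt_nonneg _, Real.sqrt_le_sqrt hr.2⟩

theorem hasDerivWithinAt_sqrt (s : ℝ) {τ : ℝ} (hτ : 0 < τ) (J : Set ℝ) :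
    HasDerivWithinAt (fun r : ℝ => (s, √r)) ((1 / (2 * √τ)) • e₂) J τ := by
  have := ((hasDerivAt_const τ s).prodMk (Real.hasDerivAt_sqrt hτ.ne')).hasDerivWithinAt (s := J)
  convert! this using 1
  simp

variable {n : ℕ} {M : Type*} [TopologicalSpace M] [ChartedSpace (EuclideanSpace ℝ (Fin n)) M]

local notation "𝔼" => EuclideanSpace ℝ (Fin n)

theorem mpd_smul {S : Set (ℝ × ℝ)} {β : ℝ × ℝ → M} {q : ℝ × ℝ} (r : ℝ) (e : ℝ × ℝ) :
    (mpd S (r • e) β q : 𝔼) = r • mpd S e β q :=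
  map_smul (mfderivWithin 𝓘(ℝ, ℝ × ℝ) (𝓡 n) β S q : ℝ × ℝ →L[ℝ] 𝔼) r e

theorem pd_smul {X F : Type*} [NormedAddCommGroup X] [NormedSpace ℝ X] [NormedAddCommGroup F]
    [NormedSpace ℝ F] {S : Set X} {f : X → F} {q : X} (r : ℝ) (e : X) :
    pd S (r • e) f q = r • pd S e f q := map_smul (fderivWithin ℝ f S q) r e

theorem isVariation_sqMap {T b ε : ℝ} (hb : 0 < b) (hbT : b ≤ T) (hε : 0 < ε) {γ : ℝ → ℝ → M}
    (hγ : ContMDiffOn 𝓘(ℝ, ℝ × ℝ) (𝓡 n) ∞ (sqMap γ) (strip ε b)) :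
    IsVariation n T (strip ε b) (sqMap γ) where
  regular := isRegularDomain_strip hε (Real.sqrt_pos.2 hb)
  time _ hq := ⟨sq_nonneg _, (Real.le_sqrt hq.2.1 hb.le).1 hq.2.2 |>.trans hbT⟩
  smooth := hγ

namespace IsVariation

variable {T b ε : ℝ} {γ : ℝ → ℝ → M}

/-- The factor is `dσ/dτ`; time `0` is excluded because the square root is not differentiable there.
-/
theorem velocity_time (h : IsVariation n T (strip ε b) (sqMap γ)) (hb : 0 < b) {s r : ℝ}
    (hs : s ∈ Ioo (-ε) ε) (hr : r ∈ Ioc 0 b) :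
    (velocity (Icc 0 b) (γ s) r : 𝔼) = (1 / (2 * √r)) • mpd (strip ε b) e₂ (sqMap γ) (s, √r) := by
  have hr' : r ∈ Icc 0 b := ⟨hr.1.le, hr.2⟩
  rw [← mpd_smul]
  exact velocity_comp (h.mdifferentiableWithinAt (mapsTo_sqrt hs hr'))
    (hasDerivWithinAt_sqrt s hr.1 _) (mapsTo_sqrt hs) rfl hr' (uniqueDiffOn_Icc hb r hr')
    (fun t ht => (sqMap_sqrt γ s ht.1).symm)

theorem velocity_parameter (h : IsVariation n T (strip ε b) (sqMap γ)) {s σ : ℝ}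
    (hs : s ∈ Ioo (-ε) ε) (hσ : σ ∈ Icc 0 √b) :
    (velocity univ (fun r => γ r (σ ^ 2)) s : 𝔼) = mpd (strip ε b) e₁ (sqMap γ) (s, σ) := by
  rw [velocity_univ (isOpen_Ioo.mem_nhds hs)]
  have hk : HasDerivWithinAt (fun r : ℝ => (r, σ)) e₁ (Ioo (-ε) ε) s :=
    ((hasDerivAt_id s).prodMk (hasDerivAt_const s σ)).hasDerivWithinAt
  exact velocity_comp (h.mdifferentiableWithinAt ⟨hs, hσ⟩) hk (fun r hr => ⟨hr, hσ⟩) rfl hs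
    (isOpen_Ioo.uniqueDiffWithinAt hs) (fun t _ => rfl)

theorem eventually_mem_dom (h : IsVariation n T (strip ε b) (sqMap γ)) {c : M} {s σ : ℝ}
    (hσ0 : 0 < σ) (hp : (s, σ) ∈ dom n (strip ε b) (sqMap γ) c) :
    ∀ᶠ r in 𝓝[Icc 0 b] (σ ^ 2), r ∈ Ioc 0 b ∧ (s, √r) ∈ dom n (strip ε b) (sqMap γ) c := by
  have hs := hp.1.1
  have hk : Tendsto (fun r : ℝ => (s, √r)) (𝓝[Icc 0 b] (σ ^ 2)) (𝓝[strip ε b] (s, σ)) := by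
    refine tendsto_nhdsWithin_iff.2 ⟨?_, eventually_of_mem self_mem_nhdsWithin fun r hr =>
      mapsTo_sqrt hs hr⟩
    have : ContinuousAt (fun r : ℝ => (s, √r)) (σ ^ 2) := by fun_prop
    have h2 := this.tendsto
    rw [Real.sqrt_sq hσ0.le] at h2
    exact h2.mono_left nhdsWithin_le_nhds
  have hd : dom n (strip ε b) (sqMap γ) c ∈ 𝓝[strip ε b] (s, σ) := by
    have := (h.smooth (s, σ) hp.1).continuousWithinAt.preimage_mem_nhdsWithin
      ((isOpen_extChartAt_source (I := 𝓡 n) c).mem_nhds hp.2)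
    exact inter_mem self_mem_nhdsWithin this
  filter_upwards [hk hd, self_mem_nhdsWithin, mem_nhdsWithin_of_mem_nhds
    (isOpen_Ioi.mem_nhds (show (0 : ℝ) < σ ^ 2 by positivity))] with r h1 h2 h3
  exact ⟨⟨h3, h2.2⟩, h1⟩

variable [IsManifold (𝓡 n) ∞ M] {g : ℝ → Metric n M}

/-- The chart used is the preferred one at `sqMap γ q`, whose derivative there is the identity. -/
theorem mpd_eq (h : IsVariation n T (strip ε b) (sqMap γ)) {q : ℝ × ℝ} (hq : q ∈ strip ε b)
    (e : ℝ × ℝ) : mpd (strip ε b) e (sqMap γ) q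
      = pd (strip ε b) e (coordMap n (sqMap γ q) (sqMap γ)) q := by
  have h1 := h.chartDeriv_mpd (mem_dom hq) e
  rwa [chartDeriv_self] at h1

/-- With `X = V/(2σ)` and `dτ = 2σ dσ`: `2σ · σ(R + |V|²/(4σ²)) = 2σ²R + |V|²/2`. -/
theorem lengthIntegrand_sq (h : IsVariation n T (strip ε b) (sqMap γ)) (hb : 0 < b) {s σ : ℝ}
    (hs : s ∈ Ioo (-ε) ε) (hσ : σ ∈ Ioo 0 √b) :
    2 * σ * lengthIntegrand g 0 b (γ s) (σ ^ 2)
      = energyDensity g (strip ε b) (sqMap γ) (s, σ) := by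
  have hσ2 : σ ^ 2 ∈ Ioc 0 b :=
    ⟨by have := hσ.1; positivity, (Real.le_sqrt hσ.1.le hb.le).1 hσ.2.le⟩
  have hv := h.velocity_time hb hs hσ2
  rw [Real.sqrt_sq hσ.1.le] at hv
  have h1 : lengthIntegrand g 0 b (γ s) (σ ^ 2) = √(σ ^ 2) * ((g (σ ^ 2)).scalarAt (γ s (σ ^ 2)) +
    (g (σ ^ 2)).form (γ s (σ ^ 2)) (velocity (Icc 0 b) (γ s) (σ ^ 2) : 𝔼)
      (velocity (Icc 0 b) (γ s) (σ ^ 2) : 𝔼)) := rfl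
  have h2 : sqMap γ (s, σ) = γ s (σ ^ 2) := rfl
  rw [h1, hv, Real.sqrt_sq hσ.1.le, energyDensity, h2]
  simp only [map_smul, smul_apply, smul_eq_mul]
  have := hσ.1.ne'
  field_simp

variable {σ : ℝ}

theorem sq_mem (hb : 0 < b) (hσ : σ ∈ Ioc 0 √b) : σ ^ 2 ∈ Ioc 0 b :=
  ⟨by have := hσ.1; positivity, (Real.le_sqrt hσ.1.le hb.le).1 hσ.2⟩

theorem zero_mem (hε : 0 < ε) : (0 : ℝ) ∈ Ioo (-ε) ε := ⟨by linarith, hε⟩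

theorem mem_strip (hε : 0 < ε) (hσ : σ ∈ Ioc 0 √b) : ((0 : ℝ), σ) ∈ strip ε b :=
  ⟨zero_mem hε, hσ.1.le, hσ.2⟩

theorem fieldX_eq (h : IsVariation n T (strip ε b) (sqMap γ)) (hb : 0 < b) (hε : 0 < ε)
    (hσ : σ ∈ Ioc 0 √b) : (fieldX b γ (σ ^ 2) : 𝔼)
      = (1 / (2 * σ)) • pd (strip ε b) e₂ (coordMap n (sqMap γ (0, σ)) (sqMap γ)) (0, σ) := by
  have hv := h.velocity_time hb (zero_mem hε) (sq_mem hb hσ)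
  rw [Real.sqrt_sq hσ.1.le, h.mpd_eq (mem_strip hε hσ)] at hv
  exact hv

theorem fieldY_eq (h : IsVariation n T (strip ε b) (sqMap γ)) (hε : 0 < ε)
    (hσ : σ ∈ Ioc 0 √b) : (fieldY γ (σ ^ 2) : 𝔼)
      = pd (strip ε b) e₁ (coordMap n (sqMap γ (0, σ)) (sqMap γ)) (0, σ) := by
  rw [← h.mpd_eq (mem_strip hε hσ)]
  exact h.velocity_parameter (zero_mem hε) ⟨hσ.1.le, hσ.2⟩

theorem nablaYY_eq (h : IsVariation n T (strip ε b) (sqMap γ)) (hε : 0 < ε)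
    (hσ : σ ∈ Ioc 0 √b) : (nablaYY g γ (σ ^ 2) : 𝔼)
      = covD (coordFlow g (sqMap γ (0, σ))) (strip ε b) (coordMap n (sqMap γ (0, σ)) (sqMap γ)) e₁
        (pd (strip ε b) e₁ (coordMap n (sqMap γ (0, σ)) (sqMap γ))) (0, σ) := by
  have hq := mem_strip hε hσ
  have hd : (0, σ) ∈ dom n (strip ε b) (sqMap γ) (sqMap γ (0, σ)) := mem_dom hq
  have hv := h.isVariationOn (sqMap γ (0, σ))
  have hf := hasDerivAt_fst_of_strip (zero_mem hε) ⟨hσ.1.le, hσ.2⟩ (hv.smooth_pd hd e₁)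
  have hs : ∀ᶠ r in 𝓝 (0 : ℝ), (r, σ) ∈ dom n (strip ε b) (sqMap γ) (sqMap γ (0, σ)) := by
    have hk : Tendsto (fun r : ℝ => (r, σ)) (𝓝 0) (𝓝[strip ε b] (0, σ)) :=
      tendsto_nhdsWithin_iff.2 ⟨Continuous.tendsto (by fun_prop) 0,
        mem_of_superset (isOpen_Ioo.mem_nhds (zero_mem hε)) fun r hr => ⟨hr, hσ.1.le, hσ.2⟩⟩
    exact hk (hv.mem_nhdsWithin _ hd)
  have h1 := covDeriv_eq (g (σ ^ 2)) (c := fun s => γ s (σ ^ 2))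
    (V := velocity univ (fun s => γ s (σ ^ 2))) hf.hasDerivWithinAt (mem_univ (0 : ℝ))
    uniqueDiffWithinAt_univ (by
      rw [nhdsWithin_univ]
      filter_upwards [hs] with r hr
      have h2 := h.velocity_parameter hr.1.1 ⟨hσ.1.le, hσ.2⟩
      exact (congrArg _ h2).trans (h.chartDeriv_mpd hr e₁))
  have h2 := h.velocity_parameter (zero_mem hε) ⟨hσ.1.le, hσ.2⟩
  rw [h.mpd_eq hq] at h2
  rw [h2] at h1
  exact h1

/-- A field along the central curve, in the square root of time. -/
theorem covDeriv_time (h : IsVariation n T (strip ε b) (sqMap γ)) (hb : 0 < b) (hε : 0 < ε)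
    (hσ : σ ∈ Ioc 0 √b) {V : ∀ t, TangentSpace (𝓡 n) (γ 0 t)} {e : ℝ × ℝ} {k : ℝ → ℝ} {k' : ℝ}
    (hk : HasDerivWithinAt k k' (Icc 0 b) (σ ^ 2))
    (hV : ∀ r ∈ Ioc 0 b, (V r : 𝔼) = k r • mpd (strip ε b) e (sqMap γ) (0, √r)) :
    ((g (σ ^ 2)).covDeriv (Icc 0 b) (γ 0) V (σ ^ 2) : 𝔼)
      = (k (σ ^ 2) / (2 * σ)) • covD (coordFlow g (sqMap γ (0, σ))) (strip ε b)
          (coordMap n (sqMap γ (0, σ)) (sqMap γ)) e₂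
          (pd (strip ε b) e (coordMap n (sqMap γ (0, σ)) (sqMap γ))) (0, σ)
        + k' • pd (strip ε b) e (coordMap n (sqMap γ (0, σ)) (sqMap γ)) (0, σ) := by
  have hq := mem_strip hε hσ
  have hd : (0, σ) ∈ dom n (strip ε b) (sqMap γ) (sqMap γ (0, σ)) := mem_dom hq
  have hv := h.isVariationOn (sqMap γ (0, σ))
  have hτ := sq_mem hb hσ
  have hτ' : σ ^ 2 ∈ Icc 0 b := ⟨hτ.1.le, hτ.2⟩
  have hsq : √(σ ^ 2) = σ := Real.sqrt_sq hσ.1.le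
  have hf := hasDerivWithinAt_comp_curve (hv.smooth_pd hd e)
    (hasDerivWithinAt_sqrt 0 hτ.1 (Icc 0 b)) (mapsTo_sqrt (zero_mem hε)) (by rw [hsq])
  -- The product rule gives the term with `k'`; the factor `1/(2σ)` in the other term is the chain
  -- rule through the square root.
  have hf2 := hk.smul hf
  have h1 := covDeriv_eq (g (σ ^ 2)) (c := γ 0) (V := V) hf2 hτ' (uniqueDiffOn_Icc hb _ hτ') (by
      filter_upwards [h.eventually_mem_dom hσ.1 hd] with r hr
      have h3 := h.chartDeriv_mpd hr.2 e
      rw [sqMap_sqrt γ 0 hr.1.1.le] at h3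
      refine (congrArg _ (hV r hr.1)).trans ?_
      rw [map_smul]
      exact congrArg (k r • ·) h3)
  have h2 := h.fieldX_eq hb hε hσ
  have h3 := hV _ hτ
  rw [hsq, h.mpd_eq hq] at h3
  have h2' : (velocity (Icc 0 b) (γ 0) (σ ^ 2) : 𝔼) = _ := h2
  rw [h2', h3, hsq, pd_smul] at h1
  refine h1.trans ?_
  have h4 : (g (σ ^ 2)).coord (γ 0 (σ ^ 2)) = coordFlow g (sqMap γ (0, σ)) (σ ^ 2) := rfl
  have h5 : extChartAt (𝓡 n) (γ 0 (σ ^ 2)) (γ 0 (σ ^ 2))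
    = coordMap n (sqMap γ (0, σ)) (sqMap γ) (0, σ) := rfl
  have h6 : covD (coordFlow g (sqMap γ (0, σ))) (strip ε b)
      (coordMap n (sqMap γ (0, σ)) (sqMap γ)) e₂
      (pd (strip ε b) e (coordMap n (sqMap γ (0, σ)) (sqMap γ))) (0, σ)
    = pd (strip ε b) e₂ (pd (strip ε b) e (coordMap n (sqMap γ (0, σ)) (sqMap γ))) (0, σ)
      + christoffel (coordFlow g (sqMap γ (0, σ)) (σ ^ 2))
        (coordMap n (sqMap γ (0, σ)) (sqMap γ) (0, σ))
        (pd (strip ε b) e₂ (coordMap n (sqMap γ (0, σ)) (sqMap γ)) (0, σ))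
        (pd (strip ε b) e (coordMap n (sqMap γ (0, σ)) (sqMap γ)) (0, σ)) := rfl
  rw [h4, h5, h6]
  simp only [map_smul, smul_apply]
  change @Eq 𝔼 _ _
  module

theorem nablaXY_eq (h : IsVariation n T (strip ε b) (sqMap γ)) (hb : 0 < b) (hε : 0 < ε)
    (hσ : σ ∈ Ioc 0 √b) : (nablaXY g b γ (σ ^ 2) : 𝔼)
      = (1 / (2 * σ)) • covD (coordFlow g (sqMap γ (0, σ))) (strip ε b)
          (coordMap n (sqMap γ (0, σ)) (sqMap γ)) e₂
          (pd (strip ε b) e₁ (coordMap n (sqMap γ (0, σ)) (sqMap γ))) (0, σ) := by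
  have := h.covDeriv_time (g := g) hb hε hσ (V := fieldY γ) (e := e₁)
    (hasDerivWithinAt_const _ _ (1 : ℝ)) (fun r hr => by
      have h1 := h.velocity_parameter (zero_mem hε)
        (σ := √r) ⟨Real.sqrt_nonneg r, Real.sqrt_le_sqrt hr.2⟩
      rw [Real.sq_sqrt hr.1.le] at h1
      rw [one_smul]
      exact h1)
  rw [zero_smul, add_zero] at this
  exact this

/-- Insert `X = V/(2σ)` and multiply by `4σ²`. The singular term `X/(2τ)` cancels exactly the
contribution of differentiating the factor `1/(2σ)`, so the resulting equation has coefficients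
regular at `σ = 0`. -/
theorem geodesic_eq (h : IsVariation n T (strip ε b) (sqMap γ)) (hb : 0 < b) (hε : 0 < ε)
    (hσ : σ ∈ Ioc 0 √b) (hgeo : IsLGeodesic g 0 b (γ 0)) :
    covD (coordFlow g (sqMap γ (0, σ))) (strip ε b) (coordMap n (sqMap γ (0, σ)) (sqMap γ)) e₂
      (pd (strip ε b) e₂ (coordMap n (sqMap γ (0, σ)) (sqMap γ))) (0, σ)
    = (2 * σ ^ 2) • gradient (coordFlow g (sqMap γ (0, σ)) (σ ^ 2))
        (scalar (coordFlow g (sqMap γ (0, σ)) (σ ^ 2)))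
        (coordMap n (sqMap γ (0, σ)) (sqMap γ) (0, σ))
      - (4 * σ) • ricciSharp (coordFlow g (sqMap γ (0, σ)) (σ ^ 2))
        (coordMap n (sqMap γ (0, σ)) (sqMap γ) (0, σ))
        (pd (strip ε b) e₂ (coordMap n (sqMap γ (0, σ)) (sqMap γ)) (0, σ)) := by
  have hτ := sq_mem hb hσ
  have hσ0 := hσ.1
  have hsq : √(σ ^ 2) = σ := Real.sqrt_sq hσ.1.le
  have hk : HasDerivWithinAt (fun r : ℝ => 1 / (2 * √r)) (-(1 / (4 * σ ^ 3))) (Icc 0 b)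
      (σ ^ 2) := by
    have := ((((Real.hasDerivAt_sqrt hτ.1.ne').const_mul 2).inv
      (by rw [hsq]; positivity)).hasDerivWithinAt (s := Icc 0 b))
    simp only [one_div]
    refine this.congr_deriv ?_
    rw [hsq]
    field_simp
    norm_num
  have h1 := h.covDeriv_time (g := g) hb hε hσ (V := velocity (Icc 0 b) (γ 0)) (e := e₂) hk
    (fun r hr => h.velocity_time hb (zero_mem hε) hr)
  have h2 := hgeo.equation (σ ^ 2) ⟨hτ.1.le, hτ.2⟩ hτ.1
  have h3 : (velocity (Icc 0 b) (γ 0) (σ ^ 2) : 𝔼) = _ := h.fieldX_eq hb hε hσ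
  have hgrad : ((g (σ ^ 2)).gradientAt (g (σ ^ 2)).scalarAt (γ 0 (σ ^ 2)) : 𝔼)
      = gradient (coordFlow g (sqMap γ (0, σ)) (σ ^ 2))
        (scalar (coordFlow g (sqMap γ (0, σ)) (σ ^ 2)))
        (coordMap n (sqMap γ (0, σ)) (sqMap γ) (0, σ)) := by
    exact congrArg (fun α => sharp ((g (σ ^ 2)).coord (γ 0 (σ ^ 2)))
      (extChartAt (𝓡 n) (γ 0 (σ ^ 2)) (γ 0 (σ ^ 2))) α)
      ((g (σ ^ 2)).scalarAt_comp_eventuallyEq (γ 0 (σ ^ 2))).fderiv_eq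
  have hric : ((g (σ ^ 2)).ricciSharpAt (γ 0 (σ ^ 2)) (velocity (Icc 0 b) (γ 0) (σ ^ 2)) : 𝔼)
      = (1 / (2 * σ)) • ricciSharp (coordFlow g (sqMap γ (0, σ)) (σ ^ 2))
        (coordMap n (sqMap γ (0, σ)) (sqMap γ) (0, σ))
        (pd (strip ε b) e₂ (coordMap n (sqMap γ (0, σ)) (sqMap γ)) (0, σ)) :=
    (congrArg (ricciSharp (coordFlow g (sqMap γ (0, σ)) (σ ^ 2))
      (coordMap n (sqMap γ (0, σ)) (sqMap γ) (0, σ))) h3).trans (map_smul _ _ _)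
  -- Quantifying over vectors of `𝔼` frees the equation from the tangent space at a varying point,
  -- so that the four coordinate expressions can be substituted.
  have h4 : ∀ D V Gr Rc : 𝔼,
      ((g (σ ^ 2)).covDeriv (Icc 0 b) (γ 0) (velocity (Icc 0 b) (γ 0)) (σ ^ 2) : 𝔼) = D →
      (velocity (Icc 0 b) (γ 0) (σ ^ 2) : 𝔼) = V →
      ((g (σ ^ 2)).gradientAt (g (σ ^ 2)).scalarAt (γ 0 (σ ^ 2)) : 𝔼) = Gr →
      ((g (σ ^ 2)).ricciSharpAt (γ 0 (σ ^ 2)) (velocity (Icc 0 b) (γ 0) (σ ^ 2)) : 𝔼) = Rc →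
      D - (1 / 2 : ℝ) • Gr + (1 / (2 * σ ^ 2)) • V + (2 : ℝ) • Rc = 0 := by
    rintro _ _ _ _ rfl rfl rfl rfl
    exact h2
  have h5 := congrArg (fun v : 𝔼 => (4 * σ ^ 2) • v) (h4 _ _ _ _ h1 h3 hgrad hric)
  simp only [hsq, smul_add, smul_sub, smul_smul, smul_zero] at h5
  have c1 : 4 * σ ^ 2 * (1 / (2 * σ) / (2 * σ)) = 1 := by field_simp; norm_num
  have c2 : 4 * σ ^ 2 * -(1 / (4 * σ ^ 3)) = -(1 / σ) := by field_simp
  have c3 : 4 * σ ^ 2 * (1 / (2 * σ ^ 2) * (1 / (2 * σ))) = 1 / σ := by field_simp; norm_num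
  have c4 : 4 * σ ^ 2 * (2 * (1 / (2 * σ))) = 4 * σ := by field_simp
  rw [c1, c2, c3, c4, one_smul] at h5
  rw [← sub_eq_zero, ← h5]
  module

theorem boundaryTerm_sq (h : IsVariation n T (strip ε b) (sqMap γ))
    (hg : IsBackwardRicciFlow g T) (hT : 0 < T) (hb : 0 < b) (hε : 0 < ε) (hσ : σ ∈ Ioc 0 √b) :
    boundaryTerm g b γ (σ ^ 2) = boundaryDensity g (strip ε b) (sqMap γ) (0, σ) := by
  have hd : (0, σ) ∈ dom n (strip ε b) (sqMap γ) (sqMap γ (0, σ)) := mem_dom (mem_strip hε hσ)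
  have h1 : boundaryTerm g b γ (σ ^ 2) = 2 * √(σ ^ 2) * (g (σ ^ 2)).form (γ 0 (σ ^ 2))
    (nablaYY g γ (σ ^ 2) : 𝔼) (fieldX b γ (σ ^ 2) : 𝔼) := rfl
  have h2 : γ 0 (σ ^ 2) = sqMap γ (0, σ) := rfl
  have hσ0 := hσ.1.ne'
  rw [h1, h.nablaYY_eq hε hσ, h.fieldX_eq hb hε hσ, h.boundaryDensity_eq hg hT hd,
    Real.sqrt_sq hσ.1.le, map_smul, h2, (g (σ ^ 2)).form_eq_coord hd.2, chartDeriv_self,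
    smul_eq_mul, ← mul_assoc, show 2 * σ * (1 / (2 * σ)) = 1 by field_simp, one_mul]
  rfl

/-- The prefactor `2σ · σ = 2σ²` absorbs one factor `1/(2σ)` for each `X`, which gives the weights
of `pd_pd_energyDensity`. The right-hand side is continuous up to `σ = 0`, whence absolute
convergence. -/
theorem secondVariationIntegrand_sq (h : IsVariation n T (strip ε b) (sqMap γ))
    (hg : IsBackwardRicciFlow g T) (hT : 0 < T) (hb : 0 < b) (hε : 0 < ε)
    (hgeo : IsLGeodesic g 0 b (γ 0)) (hσ : σ ∈ Ioc 0 √b) :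
    2 * σ * secondVariationIntegrand g b γ (σ ^ 2)
      = pd (strip ε b) e₁ (pd (strip ε b) e₁ (energyDensity g (strip ε b) (sqMap γ))) (0, σ)
        - pd (strip ε b) e₂ (boundaryDensity g (strip ε b) (sqMap γ)) (0, σ) := by
  have hd : (0, σ) ∈ dom n (strip ε b) (sqMap γ) (sqMap γ (0, σ)) := mem_dom (mem_strip hε hσ)
  have hσ0 := hσ.1.ne'
  rw [h.pd_pd_energyDensity hg hT hd (h.geodesic_eq hb hε hσ hgeo)]
  have hform : ∀ u v : 𝔼, (g (σ ^ 2)).form (sqMap γ (0, σ)) u v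
      = coordFlow g (sqMap γ (0, σ)) (σ ^ 2) (coordMap n (sqMap γ (0, σ)) (sqMap γ) (0, σ)) u v := by
    intro u v
    rw [(g (σ ^ 2)).form_eq_coord hd.2, chartDeriv_self]
    rfl
  have hhess : ∀ u v : 𝔼, (g (σ ^ 2)).hessianAt (g (σ ^ 2)).scalarAt (sqMap γ (0, σ)) u v
      = hessian (coordFlow g (sqMap γ (0, σ)) (σ ^ 2))
        (scalar (coordFlow g (sqMap γ (0, σ)) (σ ^ 2)))
        (coordMap n (sqMap γ (0, σ)) (sqMap γ) (0, σ)) u v := by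
    intro u v
    have he := (g (σ ^ 2)).scalarAt_comp_eventuallyEq (sqMap γ (0, σ))
    change hessian _ ((g (σ ^ 2)).scalarAt ∘ (extChartAt (𝓡 n) (sqMap γ (0, σ))).symm) _ u v = _
    rw [hessian, he.fderiv_eq, he.fderiv.fderiv_eq]
    rfl
  have h1 : ∀ N X Y : 𝔼, (nablaXY g b γ (σ ^ 2) : 𝔼) = N → (fieldX b γ (σ ^ 2) : 𝔼) = X →
      (fieldY γ (σ ^ 2) : 𝔼) = Y → secondVariationIntegrand g b γ (σ ^ 2) = √(σ ^ 2) *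
      (2 * (g (σ ^ 2)).form (sqMap γ (0, σ)) N N
        + 2 * (g (σ ^ 2)).form (sqMap γ (0, σ))
          (riemann (coordFlow g (sqMap γ (0, σ)) (σ ^ 2))
            (coordMap n (sqMap γ (0, σ)) (sqMap γ) (0, σ)) Y X Y) X
        + (g (σ ^ 2)).hessianAt (g (σ ^ 2)).scalarAt (sqMap γ (0, σ)) Y Y
        + 2 * nablaRicci (coordFlow g (sqMap γ (0, σ)) (σ ^ 2))
            (coordMap n (sqMap γ (0, σ)) (sqMap γ) (0, σ)) X Y Y
        - 4 * nablaRicci (coordFlow g (sqMap γ (0, σ)) (σ ^ 2))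
            (coordMap n (sqMap γ (0, σ)) (sqMap γ) (0, σ)) Y Y X) := by
    rintro _ _ _ rfl rfl rfl
    rfl
  rw [h1 _ _ _ (h.nablaXY_eq hb hε hσ) (h.fieldX_eq hb hε hσ) (h.fieldY_eq hε hσ), hform, hform,
    hhess, Real.sqrt_sq hσ.1.le]
  simp only [nablaRicci, map_smul, smul_apply, smul_eq_mul]
  field_simp
  ring

end IsVariation

end SquareRootTime

end RicciL

/-! ### The second variation formula. -/

theorem theorem2p4 {n : ℕ} {M : Type*} [TopologicalSpace M] [T2Space M] [SecondCountableTopology M]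
    [ChartedSpace (EuclideanSpace ℝ (Fin n)) M] [IsManifold (𝓡 n) ∞ M]
    (g : ℝ → RicciL.Metric n M) (T : ℝ) (hg : RicciL.IsBackwardRicciFlow g T)
    (b : ℝ) (hb : 0 < b) (hbT : b ≤ T) (ε : ℝ) (hε : 0 < ε) (γ : ℝ → ℝ → M)
    (hγ : ContMDiffOn 𝓘(ℝ, ℝ × ℝ) (𝓡 n) ∞ (fun p : ℝ × ℝ => γ p.1 (p.2 ^ 2))
      (Ioo (-ε) ε ×ˢ Icc 0 (√b)))
    (hgeo : RicciL.IsLGeodesic g 0 b (γ 0)) :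
    (∀ s ∈ Ioo (-ε) ε,
      IntervalIntegrable (RicciL.lengthIntegrand g 0 b (γ s)) MeasureTheory.volume 0 b ∧
      DifferentiableAt ℝ (fun r => RicciL.lLength g 0 b (γ r)) s) ∧
    IntervalIntegrable (RicciL.secondVariationIntegrand g b γ) MeasureTheory.volume 0 b ∧
    ∃ B₀ : ℝ, Tendsto (RicciL.boundaryTerm g b γ) (𝓝[>] 0) (𝓝 B₀) ∧
      HasDerivAt (deriv (fun s => RicciL.lLength g 0 b (γ s)))
        (RicciL.boundaryTerm g b γ b - B₀
          + ∫ τ in (0 : ℝ)..b, RicciL.secondVariationIntegrand g b γ τ) 0 := by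
  open RicciL in
  have hT : 0 < T := hb.trans_le hbT
  have ha : 0 < √b := Real.sqrt_pos.2 hb
  have h : IsVariation n T (strip ε b) (sqMap γ) := isVariation_sqMap hb hbT hε hγ
  have hreg := h.regular
  have h0 : (0 : ℝ) ∈ Ioo (-ε) ε := ⟨by linarith, hε⟩
  have hF : ∀ q ∈ strip ε b, ContDiffWithinAt ℝ ∞ (energyDensity g (strip ε b) (sqMap γ))
    (strip ε b) q := fun q hq => h.smooth_energyDensity hg hT hq
  have hW : ∀ q ∈ strip ε b, ContDiffWithinAt ℝ ∞ (boundaryDensity g (strip ε b) (sqMap γ))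
    (strip ε b) q := fun q hq => h.smooth_boundaryDensity hg hT hq
  have hF1 : ∀ q ∈ strip ε b, ContDiffWithinAt ℝ ∞
      (pd (strip ε b) e₁ (energyDensity g (strip ε b) (sqMap γ))) (strip ε b) q :=
    fun q hq => (hF q hq).pd hreg hq e₁
  have hslice : ∀ {f : ℝ × ℝ → ℝ}, (∀ q ∈ strip ε b, ContDiffWithinAt ℝ ∞ f (strip ε b) q) →
      ∀ s ∈ Ioo (-ε) ε, ContinuousOn (fun σ => f (s, σ)) (Icc 0 √b) := fun hf s hs =>
    continuousOn_slice hs fun q hq => (hf q hq).continuousWithinAt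
  have hL : ∀ s ∈ Ioo (-ε) ε, _ := fun s hs =>
    integral_comp_sq hb (hslice hF s hs) (fun σ hσ => h.lengthIntegrand_sq hb hs hσ)
  have hd1 : ∀ s ∈ Ioo (-ε) ε, HasDerivAt (fun r => lLength g 0 b (γ r))
      (∫ σ in 0..√b, pd (strip ε b) e₁ (energyDensity g (strip ε b) (sqMap γ)) (s, σ)) s := by
    intro s hs
    refine (hasDerivAt_integral_strip hε ha hF hs).congr_of_eventuallyEq ?_
    filter_upwards [isOpen_Ioo.mem_nhds hs] with r hr
    exact (hL r hr).2
  have hF11c := hslice (fun q hq => (hF1 q hq).pd hreg hq e₁) 0 h0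
  have hW2c := hslice (fun q hq => (hW q hq).pd hreg hq e₂) 0 h0
  have hSV := integral_comp_sq hb (hF11c.sub hW2c) (fun σ hσ =>
    h.secondVariationIntegrand_sq hg hT hb hε hgeo ⟨hσ.1, hσ.2.le⟩)
  have hFTC : ∫ σ in 0..√b, pd (strip ε b) e₂ (boundaryDensity g (strip ε b) (sqMap γ)) (0, σ)
      = boundaryDensity g (strip ε b) (sqMap γ) (0, √b)
        - boundaryDensity g (strip ε b) (sqMap γ) (0, 0) := by
    refine intervalIntegral.integral_eq_sub_of_hasDerivAt_of_le ha.le (hslice hW 0 h0)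
      (fun σ hσ => ?_) (hW2c.intervalIntegrable_of_Icc ha.le)
    exact (hasDerivWithinAt_snd_of_strip h0 (hW (0, σ) ⟨h0, hσ.1.le, hσ.2.le⟩)).hasDerivAt
      (Icc_mem_nhds hσ.1 hσ.2)
  have hBT : ∀ τ ∈ Ioc 0 b, boundaryTerm g b γ τ
      = boundaryDensity g (strip ε b) (sqMap γ) (0, √τ) := by
    intro τ hτ
    have := h.boundaryTerm_sq (g := g) hg hT hb hε (σ := √τ)
      ⟨Real.sqrt_pos.2 hτ.1, Real.sqrt_le_sqrt hτ.2⟩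
    rwa [Real.sq_sqrt hτ.1.le] at this
  -- The limit of the boundary term is the value at the corner `σ = 0` of the boundary density,
  -- which is continuous there although `X` itself may blow up.
  refine ⟨fun s hs => ⟨(hL s hs).1, (hd1 s hs).differentiableAt⟩, hSV.1,
    boundaryDensity g (strip ε b) (sqMap γ) (0, 0), ?_, ?_⟩
  · have hc : Tendsto (fun σ => boundaryDensity g (strip ε b) (sqMap γ) (0, σ))
        (𝓝[Icc 0 √b] 0) (𝓝 (boundaryDensity g (strip ε b) (sqMap γ) (0, 0))) :=
      hslice hW 0 h0 0 ⟨le_rfl, ha.le⟩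
    have hIoc : Ioc 0 b ∈ 𝓝[>] (0 : ℝ) := Ioc_mem_nhdsGT hb
    have hs : Tendsto Real.sqrt (𝓝[>] 0) (𝓝[Icc 0 √b] 0) := by
      refine tendsto_nhdsWithin_iff.2 ⟨?_, ?_⟩
      · have := Real.continuous_sqrt.tendsto 0
        rw [Real.sqrt_zero] at this
        exact this.mono_left nhdsWithin_le_nhds
      · filter_upwards [hIoc] with τ hτ
        exact ⟨Real.sqrt_nonneg τ, Real.sqrt_le_sqrt hτ.2⟩
    refine (hc.comp hs).congr' ?_
    filter_upwards [hIoc] with τ hτ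
    exact (hBT τ hτ).symm
  · have hd2 := hasDerivAt_integral_strip hε ha hF1 h0
    -- The first derivative is identified with the integral on a whole neighbourhood of `0`, as is
    -- needed to differentiate `deriv` once more.
    have hev : deriv (fun s => lLength g 0 b (γ s)) =ᶠ[𝓝 0] fun s =>
        ∫ σ in 0..√b, pd (strip ε b) e₁ (energyDensity g (strip ε b) (sqMap γ)) (s, σ) := by
      filter_upwards [isOpen_Ioo.mem_nhds h0] with s hs
      exact (hd1 s hs).deriv
    refine (hd2.congr_of_eventuallyEq hev).congr_deriv ?_
    rw [hSV.2, hBT b ⟨hb, le_rfl⟩, ← hFTC]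
    refine (sub_eq_iff_eq_add'.1 ?_).trans rfl
    exact (intervalIntegral.integral_sub (hF11c.intervalIntegrable_of_Icc ha.le)
      (hW2c.intervalIntegrable_of_Icc ha.le)).symm
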